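/- **Theorem 3.2 (Compensated compactness framework).** Let $\Omega\subset\mathbb R^d$ be open and bounded, and let $g=(g_{ij})_{1\le i,j\le d}$ be a Riemannian metric of class $C^2$ on $\Omega$, with inverse $(g^{ij})$. Put (repeated indices are summed; $i,j,k,l,m,n$ run from $1$ to $d$ and $a,b,b',c$ from $1$ to $N$) $$\Gamma^k_{ij}=\tfrac12 g^{kl}(\partial_j g_{il}+\partial_i g_{jl}-\partial_l g_{ij}),\qquad R_{ijkl}=g_{lm}\big(\partial_k\Gamma^m_{ij}-\partial_j\Gamma^m_{ik}+\Gamma^n_{ij}\Gamma^m_{nk}-\Gamma^n_{ik}\Gamma^m_{nj}\big).$$ The Gauss–Codazzi–Ricci system for $(h^a_{ij},\kappa^a_{lb})$ is, for all values of the free indices, $$h^a_{ji}h^a_{kl}-h^a_{ki}h^a_{jl}=R_{ijkl},$$ $$\partial_k h^a_{lj}-\partial_l h^a_{kj}+\Gamma^m_{lj}h^a_{km}-\Gamma^m_{kj}h^a_{lm}+\kappa^a_{kb}h^b_{lj}-\kappa^a_{lb}h^b_{kj}=0,$$ $$\partial_k\kappa^a_{lb}-\partial_l\kappa^a_{kb}-g^{mn}\big(h^a_{ml}h^b_{kn}-h^a_{mk}h^b_{ln}\big)+\kappa^a_{kc}\kappa^c_{lb}-\kappa^a_{lc}\kappa^c_{kb}=0.$$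 Let $(h^{a,\varepsilon}_{ij},\kappa^{a,\varepsilon}_{lb})$, $\varepsilon=\varepsilon_n$, $n\in\mathbb N$, be a sequence of fields in $L^2(\Omega)$ with $h^{a,\varepsilon}_{ij}=h^{a,\varepsilon}_{ji}$, and let $C>0$. Write $\|(h,\kappa)\|_{L^2(\Omega)}=\big(\sum\|h^a_{ij}\|_{L^2(\Omega)}^2+\sum\|\kappa^a_{lb}\|_{L^2(\Omega)}^2\big)^{1/2}$. Assume: * (A.1) $\|(h^{a,\varepsilon}_{ij},\kappa^{a,\varepsilon}_{lb})\|_{L^2(\Omega)}\le C$ for all $n$; * (A.2) for all indices, the distributions $\partial_k h^{a,\varepsilon}_{lj}-\partial_l h^{a,\varepsilon}_{kj}$ and $\partial_k\kappa^{a,\varepsilon}_{lb}-\partial_l\kappa^{a,\varepsilon}_{kb}$, $n\in\mathbb N$, are confined in a compact subset of $H^{-1}_{loc}(\Omega)$; * (A.3) $(h^{a,\varepsilon}_{ij},\kappa^{a,\varepsilon}_{lb})$ satisfies each of the equations of the system, in the sense of distributions on $\Omega$, up to an error that tends to $0$ in the sense of distributions as $n\to\infty$. Then there are a subsequence (not relabelled)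 and a field $(h^a_{ij},\kappa^a_{lb})\in L^2(\Omega)$ such that $(h^{a,\varepsilon}_{ij},\kappa^{a,\varepsilon}_{lb})\rightharpoonup(h^a_{ij},\kappa^a_{lb})$ weakly in $L^2(\Omega)$ and: 1. $\|(h^a_{ij},\kappa^a_{lb})\|_{L^2(\Omega)}\le C$; 2. the quadratic terms of the system are weakly continuous along the subsequence: in the sense of distributions, and for all indices (no summation over $a$, $b$, $b'$ here), $$h^{a,\varepsilon}_{lj}h^{b,\varepsilon}_{ki}-h^{a,\varepsilon}_{kj}h^{b,\varepsilon}_{li}\to h^a_{lj}h^b_{ki}-h^a_{kj}h^b_{li},$$ $$\kappa^{a,\varepsilon}_{kb}\kappa^{b',\varepsilon}_{lc}-\kappa^{a,\varepsilon}_{lb}\kappa^{b',\varepsilon}_{kc}\to\kappa^a_{kb}\kappa^{b'}_{lc}-\kappa^a_{lb}\kappa^{b'}_{kc},$$ $$\kappa^{a,\varepsilon}_{kb}h^{b',\varepsilon}_{li}-\kappa^{a,\varepsilon}_{lb}h^{b',\varepsilon}_{ki}\to\kappa^a_{kb}h^{b'}_{li}-\kappa^a_{lb}h^{b'}_{ki},$$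 and likewise the terms $h^a_{ji}h^a_{kl}-h^a_{ki}h^a_{jl}$, $\ \kappa^a_{kb}h^b_{lj}-\kappa^a_{lb}h^b_{kj}$, $\ g^{mn}(h^a_{ml}h^b_{kn}-h^a_{mk}h^b_{ln})$ and $\kappa^a_{kc}\kappa^c_{lb}-\kappa^a_{lc}\kappa^c_{kb}$ (summed over repeated indices) of the system, evaluated on the subsequence, converge in the sense of distributions to the same terms evaluated on $(h^a_{ij},\kappa^a_{lb})$; 3. $(h^a_{ij},\kappa^a_{lb})$ is a weak solution of the Gauss–Codazzi–Ricci system, that is, it satisfies all three families of equations in the sense of distributions on $\Omega$. Moreover $h^a_{ij}=h^a_{ji}$, and if $\kappa^{a,\varepsilon}_{lb}=-\kappa^{b,\varepsilon}_{la}$ for all $n$, then $\kappa^a_{lb}=-\kappa^b_{la}$. -/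

import Mathlib

open MeasureTheory Filter Topology TopologicalSpace
open scoped Distributions LineDeriv UniformConvergence ENNReal

noncomputable section

namespace GaussCodazziRicci

/-- The Euclidean space `ℝ^d`. -/
abbrev E (d : ℕ) : Type := EuclideanSpace ℝ (Fin d)

/-- The `i`-th standard basis vector of `ℝ^d`. -/
def e {d : ℕ} (i : Fin d) : E d := EuclideanSpace.single i (1 : ℝ)

/-- The classical partial derivative `∂f/∂x^i`. -/
def pd {d : ℕ} (i : Fin d) (f : E d → ℝ) (x : E d) : ℝ := fderiv ℝ f x (e i)

/-! ### Geometry of the given metric -/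

/-- The Christoffel symbol `Γ^k_{ij} = ½ g^{kl} (∂_j g_{il} + ∂_i g_{jl} - ∂_l g_{ij})`. -/
def christoffel {d : ℕ} (g : E d → Matrix (Fin d) (Fin d) ℝ) (k i j : Fin d) (x : E d) : ℝ :=
  (1 / 2 : ℝ) * ∑ l, (g x)⁻¹ k l *
    (pd j (fun y => g y i l) x + pd i (fun y => g y j l) x - pd l (fun y => g y i j) x)

/-- The Riemann curvature tensor
`R_{ijkl} = g_{lm} (∂_k Γ^m_{ij} - ∂_j Γ^m_{ik} + Γ^n_{ij} Γ^m_{nk} - Γ^n_{ik} Γ^m_{nj})`. -/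
def riemann {d : ℕ} (g : E d → Matrix (Fin d) (Fin d) ℝ) (i j k l : Fin d) (x : E d) : ℝ :=
  ∑ m, g x l m *
    (pd k (christoffel g m i j) x - pd j (christoffel g m i k) x
      + ∑ n, (christoffel g n i j x * christoffel g m n k x
        - christoffel g n i k x * christoffel g m n j x))

/-- `g` is a Riemannian metric of class `C²` on `Ω`, given by its matrix of coefficients. -/
structure IsMetricOn {d : ℕ} (Ω : Opens (E d)) (g : E d → Matrix (Fin d) (Fin d) ℝ) : Prop where
  contDiffOn : ∀ i j, ContDiffOn ℝ 2 (fun x => g x i j) (Ω : Set (E d))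
  posDef : ∀ x ∈ Ω, (g x).PosDef

/-! ### The fields -/

/-- A field `(h^a_{ij}, κ^a_{lb})`; `h a i j` is `h^a_{ij}` and `κ a l b` is `κ^a_{lb}`. Only the
values on the domain `Ω` matter. -/
structure Field (d N : ℕ) where
  h : Fin N → Fin d → Fin d → E d → ℝ
  κ : Fin N → Fin d → Fin N → E d → ℝ

namespace Field

variable {d N : ℕ}

/-- All components belong to `L²(Ω)`. -/
def MemL2 (Ω : Opens (E d)) (F : Field d N) : Prop :=
  (∀ a i j, MemLp (F.h a i j) 2 (volume.restrict (Ω : Set (E d)))) ∧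
  (∀ a l b, MemLp (F.κ a l b) 2 (volume.restrict (Ω : Set (E d))))

/-- The norm `‖(h, κ)‖_{L²(Ω)} = (∑ ‖h^a_{ij}‖²_{L²(Ω)} + ∑ ‖κ^a_{lb}‖²_{L²(Ω)})^{1/2}`. -/
def l2Norm (Ω : Opens (E d)) (F : Field d N) : ℝ≥0∞ :=
  ((∑ a, ∑ i, ∑ j, eLpNorm (F.h a i j) 2 (volume.restrict (Ω : Set (E d))) ^ 2)
    + ∑ a, ∑ l, ∑ b, eLpNorm (F.κ a l b) 2 (volume.restrict (Ω : Set (E d))) ^ 2) ^ (1 / 2 : ℝ)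

/-- `h^a_{ij} = h^a_{ji}` (almost everywhere in `Ω`). -/
def IsSymm (Ω : Opens (E d)) (F : Field d N) : Prop :=
  ∀ a i j, ∀ᵐ x ∂(volume.restrict (Ω : Set (E d))), F.h a i j x = F.h a j i x

/-- `κ^a_{lb} = -κ^b_{la}` (almost everywhere in `Ω`). -/
def IsAntisymm (Ω : Opens (E d)) (F : Field d N) : Prop :=
  ∀ a l b, ∀ᵐ x ∂(volume.restrict (Ω : Set (E d))), F.κ a l b x = - F.κ b l a x

/-- The quadratic terms of the Gauss equations: `h^a_{ji} h^a_{kl} - h^a_{ki} h^a_{jl}`. -/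
def gaussQuad (F : Field d N) (i j k l : Fin d) (x : E d) : ℝ :=
  ∑ a, (F.h a j i x * F.h a k l x - F.h a k i x * F.h a j l x)

/-- The linear terms of order zero of the Codazzi equations:
`Γ^m_{lj} h^a_{km} - Γ^m_{kj} h^a_{lm}`. -/
def codazziLin (g : E d → Matrix (Fin d) (Fin d) ℝ) (F : Field d N) (a : Fin N) (j k l : Fin d)
    (x : E d) : ℝ :=
  ∑ m, (christoffel g m l j x * F.h a k m x - christoffel g m k j x * F.h a l m x)

/-- The quadratic terms of the Codazzi equations: `κ^a_{kb} h^b_{lj} - κ^a_{lb} h^b_{kj}`. -/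
def codazziQuad (F : Field d N) (a : Fin N) (j k l : Fin d) (x : E d) : ℝ :=
  ∑ b, (F.κ a k b x * F.h b l j x - F.κ a l b x * F.h b k j x)

/-- The terms of the Ricci equations quadratic in `h`:
`g^{mn} (h^a_{ml} h^b_{kn} - h^a_{mk} h^b_{ln})`. -/
def ricciQuadH (g : E d → Matrix (Fin d) (Fin d) ℝ) (F : Field d N) (a b : Fin N) (k l : Fin d)
    (x : E d) : ℝ :=
  ∑ m, ∑ n, (g x)⁻¹ m n * (F.h a m l x * F.h b k n x - F.h a m k x * F.h b l n x)

/-- The terms of the Ricci equations quadratic in `κ`: `κ^a_{kc} κ^c_{lb} - κ^a_{lc} κ^c_{kb}`. -/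
def ricciQuadK (F : Field d N) (a b : Fin N) (k l : Fin d) (x : E d) : ℝ :=
  ∑ c, (F.κ a k c x * F.κ c l b x - F.κ a l c x * F.κ c k b x)

end Field

/-! ### Distributions -/

/-- The regular distribution `φ ↦ ∫ φ u` on `Ω` given by a function `u ∈ L¹_loc(Ω)`. -/
def toDistr {d : ℕ} (Ω : Opens (E d)) (u : E d → ℝ) : 𝓓'(Ω, ℝ) :=
  (TestFunction.integralAgainstBilinCLM (ContinuousLinearMap.mul ℝ ℝ) volume u : 𝓓(Ω, ℝ) →L[ℝ] ℝ)

/-- The `(k, l)` entry `∂w_l/∂x^k - ∂w_k/∂x^l` of the distributional curl of `w`. -/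
def curl {d : ℕ} (Ω : Opens (E d)) (w : Fin d → E d → ℝ) (k l : Fin d) : 𝓓'(Ω, ℝ) :=
  (∂_{(e k : E d)} (toDistr Ω (w l))) - (∂_{(e l : E d)} (toDistr Ω (w k)))

/-- `T n → S` in the sense of distributions. -/
def TendstoDistr {d : ℕ} {Ω : Opens (E d)} (T : ℕ → 𝓓'(Ω, ℝ)) (S : 𝓓'(Ω, ℝ)) : Prop :=
  ∀ φ : 𝓓(Ω, ℝ), Tendsto (fun n => T n φ) atTop (𝓝 (S φ))

/-- `u n ⇀ v` weakly in `L²(Ω)`. -/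
def TendstoWeakL2 {d : ℕ} (Ω : Opens (E d)) (u : ℕ → E d → ℝ) (v : E d → ℝ) : Prop :=
  ∀ f : E d → ℝ, MemLp f 2 (volume.restrict (Ω : Set (E d))) →
    Tendsto (fun n => ∫ x in (Ω : Set (E d)), u n x * f x) atTop
      (𝓝 (∫ x in (Ω : Set (E d)), v x * f x))

/-! ### The space `H⁻¹_loc(Ω)` -/

/-- The norm `(∫ |φ|² + ∫ |∇φ|²)^{1/2}` of a test function in `H¹`. -/
def h1Norm {d : ℕ} {Ω : Opens (E d)} (φ : 𝓓(Ω, ℝ)) : ℝ :=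
  Real.sqrt ((∫ x, φ x ^ 2) + ∑ i, ∫ x, pd i φ x ^ 2)

/-- `H⁻¹_loc(Ω)`: the distributions on `Ω` that are, for each compact `K ⊆ Ω`, bounded in the `H¹`
norm on the test functions supported in `K`. -/
structure HMinusOneLoc {d : ℕ} (Ω : Opens (E d)) where
  toDistribution : 𝓓'(Ω, ℝ)
  bounded : ∀ K : Set (E d), IsCompact K → K ⊆ Ω →
    ∃ C : ℝ, ∀ φ : 𝓓(Ω, ℝ), tsupport φ ⊆ K → |toDistribution φ| ≤ C * h1Norm φ

/-- The sets of test functions that are supported in a common compact subset of `Ω` and bounded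
in `H¹`. -/
def h1BoundedSets {d : ℕ} (Ω : Opens (E d)) : Set (Set 𝓓(Ω, ℝ)) :=
  {B | ∃ (K : Set (E d)) (M : ℝ), IsCompact K ∧ K ⊆ Ω ∧ ∀ φ ∈ B, tsupport φ ⊆ K ∧ h1Norm φ ≤ M}

/-- The topology of `H⁻¹_loc(Ω)`: uniform convergence on each of the sets `h1BoundedSets Ω`; it is
given by the seminorms `T ↦ sup {|T φ| : supp φ ⊆ K, ‖φ‖_{H¹} ≤ 1}`, `K ⊆ Ω` compact. -/
instance {d : ℕ} (Ω : Opens (E d)) : TopologicalSpace (HMinusOneLoc Ω) :=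
  TopologicalSpace.induced
    (fun T => UniformOnFun.ofFun (h1BoundedSets Ω) (fun φ : 𝓓(Ω, ℝ) => T.toDistribution φ))
    inferInstance

/-- The distributions `T n` are confined in a compact subset of `H⁻¹_loc(Ω)`. -/
def ConfinedInCompactHMinusOneLoc {d : ℕ} {Ω : Opens (E d)} (T : ℕ → 𝓓'(Ω, ℝ)) : Prop :=
  ∃ 𝒦 : Set (HMinusOneLoc Ω), IsCompact 𝒦 ∧ ∀ n, ∃ S ∈ 𝒦, S.toDistribution = T n

/-! ### The Gauss–Codazzi–Ricci system -/

section System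

variable {d N : ℕ} (Ω : Opens (E d)) (g : E d → Matrix (Fin d) (Fin d) ℝ) (F : Field d N)

/-- Left-hand side minus right-hand side of the Gauss equation. -/
def gaussResidual (i j k l : Fin d) : 𝓓'(Ω, ℝ) :=
  toDistr Ω (F.gaussQuad i j k l) - toDistr Ω (riemann g i j k l)

/-- Left-hand side of the Codazzi equation. -/
def codazziResidual (a : Fin N) (j k l : Fin d) : 𝓓'(Ω, ℝ) :=
  curl Ω (fun i => F.h a i j) k l + toDistr Ω (F.codazziLin g a j k l)
    + toDistr Ω (F.codazziQuad a j k l)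

/-- Left-hand side of the Ricci equation. -/
def ricciResidual (a b : Fin N) (k l : Fin d) : 𝓓'(Ω, ℝ) :=
  curl Ω (fun i => F.κ a i b) k l - toDistr Ω (F.ricciQuadH g a b k l)
    + toDistr Ω (F.ricciQuadK a b k l)

/-- `F ∈ L²(Ω)` satisfies the Gauss, Codazzi and Ricci equations in the sense of distributions. -/
structure IsWeakSolution : Prop where
  memL2 : F.MemL2 Ω
  gauss : ∀ i j k l, gaussResidual Ω g F i j k l = 0
  codazzi : ∀ a j k l, codazziResidual Ω g F a j k l = 0
  ricci : ∀ a b k l, ricciResidual Ω g F a b k l = 0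

end System

/-- Framework (A) for a sequence of fields on `Ω`, with the bound `C`. -/
structure FrameworkA {d N : ℕ} (Ω : Opens (E d)) (g : E d → Matrix (Fin d) (Fin d) ℝ)
    (F : ℕ → Field d N) (C : ℝ) : Prop where
  memL2 : ∀ n, (F n).MemL2 Ω
  bound : ∀ n, (F n).l2Norm Ω ≤ ENNReal.ofReal C
  compact_h : ∀ a j k l,
    ConfinedInCompactHMinusOneLoc (fun n => curl Ω (fun i => (F n).h a i j) k l)
  compact_κ : ∀ a b k l,
    ConfinedInCompactHMinusOneLoc (fun n => curl Ω (fun i => (F n).κ a i b) k l)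
  codazzi : ∀ a j k l, TendstoDistr (fun n => codazziResidual Ω g (F n) a j k l) 0
  ricci : ∀ a b k l, TendstoDistr (fun n => ricciResidual Ω g (F n) a b k l) 0
  gauss : ∀ i j k l, TendstoDistr (fun n => gaussResidual Ω g (F n) i j k l) 0

/-- Convergence, in the sense of distributions, of the quadratic terms of the system along a
sequence of fields: the antisymmetrized products from which they are built, and the quadratic
terms themselves as they stand in the Gauss, Codazzi and Ricci equations. -/
structure QuadraticTermsConverge {d N : ℕ} (Ω : Opens (E d))
    (g : E d → Matrix (Fin d) (Fin d) ℝ) (F : ℕ → Field d N) (G : Field d N) : Prop where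
  hh : ∀ a b i j k l, TendstoDistr
    (fun n => toDistr Ω
      (fun x => (F n).h a l j x * (F n).h b k i x - (F n).h a k j x * (F n).h b l i x))
    (toDistr Ω (fun x => G.h a l j x * G.h b k i x - G.h a k j x * G.h b l i x))
  κκ : ∀ a b b' c k l, TendstoDistr
    (fun n => toDistr Ω
      (fun x => (F n).κ a k b x * (F n).κ b' l c x - (F n).κ a l b x * (F n).κ b' k c x))
    (toDistr Ω (fun x => G.κ a k b x * G.κ b' l c x - G.κ a l b x * G.κ b' k c x))
  κh : ∀ a b b' i k l, TendstoDistr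
    (fun n => toDistr Ω
      (fun x => (F n).κ a k b x * (F n).h b' l i x - (F n).κ a l b x * (F n).h b' k i x))
    (toDistr Ω (fun x => G.κ a k b x * G.h b' l i x - G.κ a l b x * G.h b' k i x))
  gauss : ∀ i j k l, TendstoDistr
    (fun n => toDistr Ω ((F n).gaussQuad i j k l)) (toDistr Ω (G.gaussQuad i j k l))
  codazzi : ∀ a j k l, TendstoDistr
    (fun n => toDistr Ω ((F n).codazziQuad a j k l)) (toDistr Ω (G.codazziQuad a j k l))
  ricciH : ∀ a b k l, TendstoDistr
    (fun n => toDistr Ω ((F n).ricciQuadH g a b k l)) (toDistr Ω (G.ricciQuadH g a b k l))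
  ricciK : ∀ a b k l, TendstoDistr
    (fun n => toDistr Ω ((F n).ricciQuadK a b k l)) (toDistr Ω (G.ricciQuadK a b k l))

end GaussCodazziRicci

end

/-! Weak limits of products are controlled by the curl-curl lemma, a form of the div-curl lemma: if
two sequences of fields converge weakly in `L²` and their curls are compact in `H⁻¹_loc`, then `v_k
w_l - v_l w_k` converges to the same expression in the limits. Every quadratic term of the system is
a sum of such antisymmetrized products, with continuous coefficients in the Ricci term, and the
remaining terms are linear in the field or do not involve it. Hence all residuals pass to the limit,
where they must vanish.

For the curl-curl lemma, subtract the limits and localize, so that `a = χ v` and `b = φ w` are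
compactly supported and weakly null. Let `r = (1 - cΔ)⁻¹` with `c = (2π)⁻²`. Pointwise convergence
of Fourier transforms gives `r a → 0` and `r b → 0` in `L²` (`tendsto_resolvent`); energy identities
bound their second derivatives and send the first ones to zero. Thus `∂_m r(b_l)` is bounded in `H¹`
and null in `L²`, and pairing it with the curl of `a` gives zero in the limit. Therefore `⟪a_k, b_l⟫
≈ -c ∑ ⟪a_k, ∂_m∂_m r(b_l)⟫ ≈ -c ∑ ⟪a_m, ∂_k∂_m r(b_l)⟫ = -c ∑ ⟪b_l, ∂_k∂_m r(a_m)⟫`.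
Antisymmetrizing in `k, l` leaves the curl of `b` paired with `∂_m r(a_m)`, which tends to zero as
well (`tendsto_inner_sub_inner`).

Compactness of the curls enters only through `ConfinedInCompactHMinusOneLoc.tendsto`: distributions
from a compact set tend to zero along any sequence of test functions with supports in a common
compact set that is bounded in `H¹` and null in `L²`. The limit of the curls need not be identified.
-/

noncomputable section

namespace GaussCodazziRicci

open scoped SchwartzMap FourierTransform Laplacian RealInnerProductSpace ContDiff Manifold

/-! ### Schwartz functions in `L²` and the resolvent of the Laplacian. -/

section

variable {d : ℕ}

/-- The Hilbert space `L²(ℝ^d)`. -/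
abbrev L2 (d : ℕ) : Type := Lp ℝ 2 (volume : Measure (E d))

/-- The embedding of the Schwartz space into `L²(ℝ^d)`. -/
def toL2 : 𝓢(E d, ℝ) →L[ℝ] L2 d := SchwartzMap.toLpCLM ℝ ℝ 2 volume

/-- The partial derivative as an operator on the Schwartz space. -/
def D (i : Fin d) : 𝓢(E d, ℝ) →L[ℝ] 𝓢(E d, ℝ) := LineDeriv.lineDerivOpCLM ℝ 𝓢(E d, ℝ) (e i)

lemma D_eq (i : Fin d) (f : 𝓢(E d, ℝ)) : D i f = ∂_{(e i : E d)} f := rfl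

lemma D_apply (i : Fin d) (f : 𝓢(E d, ℝ)) (x : E d) : D i f x = pd i f x := rfl

lemma coeFn_toL2 (f : 𝓢(E d, ℝ)) : toL2 f =ᵐ[volume] f := f.coeFn_toLp 2 volume

lemma inner_toL2_right (v : L2 d) (f : 𝓢(E d, ℝ)) : ⟪v, toL2 f⟫ = ∫ x, v x * f x := by
  rw [L2.inner_def]
  refine integral_congr_ae ?_
  filter_upwards [coeFn_toL2 f] with x hx
  rw [hx]
  simp [mul_comm]

lemma inner_toL2 (f g : 𝓢(E d, ℝ)) : ⟪toL2 f, toL2 g⟫ = ∫ x, f x * g x := by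
  rw [inner_toL2_right]
  refine integral_congr_ae ?_
  filter_upwards [coeFn_toL2 f] with x hx
  rw [hx]

lemma D_comm (i j : Fin d) (f : 𝓢(E d, ℝ)) : D i (D j f) = D j (D i f) := by
  ext x
  have hf : ContDiff ℝ 2 f := f.smooth 2
  have key : ∀ v w : E d, fderiv ℝ (fun y => fderiv ℝ f y w) x v
      = fderiv ℝ (fderiv ℝ f) x v w := by
    intro v w
    rw [fderiv_clm_apply]
    · simp
    · exact ((hf.fderiv_right (m := 1) (by norm_num)).differentiable (by norm_num)).differentiableAt
    · fun_prop
  have hs : IsSymmSndFDerivAt ℝ f x := hf.contDiffAt.isSymmSndFDerivAt (by simp)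
  change fderiv ℝ (fun y => fderiv ℝ f y (e j)) x (e i)
    = fderiv ℝ (fun y => fderiv ℝ f y (e i)) x (e j)
  rw [key, key]
  exact hs _ _

lemma inner_D_right (i : Fin d) (f g : 𝓢(E d, ℝ)) :
    ⟪toL2 f, toL2 (D i g)⟫ = -⟪toL2 (D i f), toL2 g⟫ := by
  rw [inner_toL2, inner_toL2]
  exact SchwartzMap.integral_mul_lineDerivOp_right_eq_neg_left f g (e i)

lemma inner_D_D (i j : Fin d) (f g : 𝓢(E d, ℝ)) :
    ⟪toL2 f, toL2 (D i (D j g))⟫ = ⟪toL2 (D i (D j f)), toL2 g⟫ := by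
  rw [inner_D_right, inner_D_right, neg_neg, D_comm]

/-! ### The resolvent of the Laplacian -/

/-- The operator `1 - (2π)⁻² Δ` on Schwartz functions. -/
def helmholtz : 𝓢(E d, ℝ) →L[ℝ] 𝓢(E d, ℝ) :=
  ContinuousLinearMap.id ℝ _ - (((2 * Real.pi) ^ 2)⁻¹ : ℝ) • ∑ i, D i ∘L D i

lemma helmholtz_apply (u : 𝓢(E d, ℝ)) :
    helmholtz u = u - (((2 * Real.pi) ^ 2)⁻¹ : ℝ) • ∑ i, D i (D i u) := by
  simp [helmholtz]

lemma laplacian_eq_sum_D (u : 𝓢(E d, ℝ)) : Δ u = ∑ i, D i (D i u) := by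
  rw [SchwartzMap.laplacian_eq_sum (EuclideanSpace.basisFun (Fin d) ℝ)]
  simp [D_eq, e]

/-- Complexification of a real Schwartz function. -/
def toComplex : 𝓢(E d, ℝ) →L[ℝ] 𝓢(E d, ℂ) := SchwartzMap.postcompCLM Complex.ofRealCLM

lemma toComplex_apply (f : 𝓢(E d, ℝ)) (x : E d) : toComplex f x = (f x : ℂ) := rfl

/-- The real part of a complex Schwartz function. -/
def rePart : 𝓢(E d, ℂ) →L[ℝ] 𝓢(E d, ℝ) := SchwartzMap.postcompCLM Complex.reCLM

lemma rePart_lineDeriv (v : E d) (f : 𝓢(E d, ℂ)) : ∂_{v} (rePart f) = rePart (∂_{v} f) := by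
  ext x
  change fderiv ℝ (Complex.reCLM ∘ f) x v = Complex.reCLM (fderiv ℝ f x v)
  rw [(Complex.reCLM.hasFDerivAt.comp x (f.hasFDerivAt x)).fderiv]
  rfl

lemma rePart_laplacian (f : 𝓢(E d, ℂ)) : Δ (rePart f) = rePart (Δ f) := by
  rw [SchwartzMap.laplacian_eq_sum (EuclideanSpace.basisFun (Fin d) ℝ),
    SchwartzMap.laplacian_eq_sum (EuclideanSpace.basisFun (Fin d) ℝ), map_sum]
  simp [rePart_lineDeriv]

lemma hasTemperateGrowth_symbol :
    (fun ξ : E d => (1 + ‖ξ‖ ^ 2) ^ (-1 : ℝ)).HasTemperateGrowth := by fun_prop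

/-- With the Fourier kernel `exp(-2πi⟪x, ξ⟫)`, the factor `(2π)⁻²` gives `helmholtz` the symbol `1 +
|ξ|²`, which is inverted by a multiplier of temperate growth. The equation is solved over `ℂ`;
taking real parts commutes with the Laplacian and does not increase the `L²` norm, which Plancherel
computes. -/
lemma exists_resolvent (b : 𝓢(E d, ℝ)) : ∃ u : 𝓢(E d, ℝ), helmholtz u = b ∧
    ‖toL2 u‖ ^ 2 ≤ ∫ ξ, ((1 + ‖ξ‖ ^ 2)⁻¹ * ‖(𝓕 (toComplex b)) ξ‖) ^ 2 := by
  set m : E d → ℝ := fun ξ : E d => (1 + ‖ξ‖ ^ 2) ^ (-1 : ℝ) with hm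
  have hmt : m.HasTemperateGrowth := hasTemperateGrowth_symbol
  set U : 𝓢(E d, ℂ) := SchwartzMap.fourierMultiplierCLM ℂ m (toComplex b) with hU
  refine ⟨rePart U, ?_, ?_⟩
  · have h2 : (fun ξ : E d => ‖ξ‖ ^ 2).HasTemperateGrowth := by fun_prop
    have hL : U - (((2 * Real.pi) ^ 2)⁻¹ : ℝ) • Δ U = toComplex b := by
      rw [SchwartzMap.laplacian_eq_fourierMultiplierCLM, hU,
        SchwartzMap.fourierMultiplierCLM_fourierMultiplierCLM_apply h2 hmt, smul_smul]
      have : (((2 * Real.pi) ^ 2)⁻¹ : ℝ) * (-(2 * Real.pi) ^ 2) = -1 := by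
        field_simp
      rw [this, neg_smul, one_smul, sub_neg_eq_add]
      have hs : (m + (fun ξ : E d => ‖ξ‖ ^ 2) * m) = fun _ => (1 : ℝ) := by
        ext ξ
        have : (1 + ‖ξ‖ ^ 2) ≠ 0 := by positivity
        simp only [hm, Pi.add_apply, Pi.mul_apply, Real.rpow_neg_one]
        field_simp
      have hadd : SchwartzMap.fourierMultiplierCLM ℂ m (toComplex b)
          + SchwartzMap.fourierMultiplierCLM ℂ ((fun ξ : E d => ‖ξ‖ ^ 2) * m) (toComplex b)
          = SchwartzMap.fourierMultiplierCLM ℂ (m + (fun ξ : E d => ‖ξ‖ ^ 2) * m)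
            (toComplex b) := by
        simp only [SchwartzMap.fourierMultiplierCLM_apply]
        rw [SchwartzMap.smulLeftCLM_add hmt (h2.mul hmt)]
        simp [FourierTransform.fourierInv_add]
      rw [hadd, hs]
      simp
    rw [helmholtz_apply, ← laplacian_eq_sum_D, rePart_laplacian, ← map_smul, ← map_sub, hL]
    rfl
  · have h1 : ∀ ξ, 𝓕 U ξ = (((1 + ‖ξ‖ ^ 2)⁻¹ : ℝ) : ℂ) * 𝓕 (toComplex b) ξ := by
      intro ξ
      rw [hU, SchwartzMap.fourierMultiplierCLM_apply, FourierTransform.fourier_fourierInv_eq,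
        SchwartzMap.smulLeftCLM_apply_apply hmt]
      simp [hm, Real.rpow_neg_one]
    have h2 : ∫ ξ, ((1 + ‖ξ‖ ^ 2)⁻¹ * ‖(𝓕 (toComplex b)) ξ‖) ^ 2 = ∫ x, ‖U x‖ ^ 2 := by
      rw [← SchwartzMap.integral_norm_sq_fourier]
      refine integral_congr_ae (.of_forall fun ξ => ?_)
      simp only [h1, norm_mul, Complex.norm_real, Real.norm_eq_abs]
      rw [abs_of_nonneg (by positivity)]
    rw [h2, ← real_inner_self_eq_norm_sq, inner_toL2]
    refine integral_mono_of_nonneg (.of_forall fun x => mul_self_nonneg _) ?_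
      (.of_forall fun x => ?_)
    · exact (memLp_two_iff_integrable_sq_norm U.continuous.aestronglyMeasurable).1 (U.memLp 2)
    · change (U x).re * (U x).re ≤ ‖U x‖ ^ 2
      rw [← sq, ← sq_abs]
      exact pow_le_pow_left₀ (abs_nonneg _) (Complex.abs_re_le_norm _) 2

/-- The resolvent `(1 - (2π)⁻² Δ)⁻¹` on Schwartz functions. -/
def resolvent (b : 𝓢(E d, ℝ)) : 𝓢(E d, ℝ) := (exists_resolvent b).choose

lemma helmholtz_resolvent (b : 𝓢(E d, ℝ)) : helmholtz (resolvent b) = b :=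
  (exists_resolvent b).choose_spec.1

lemma norm_resolvent_sq_le (b : 𝓢(E d, ℝ)) : ‖toL2 (resolvent b)‖ ^ 2 ≤
    ∫ ξ, ((1 + ‖ξ‖ ^ 2)⁻¹ * ‖(𝓕 (toComplex b)) ξ‖) ^ 2 :=
  (exists_resolvent b).choose_spec.2

end

/-! ### Strong convergence of resolvents and the curl-curl lemma for Schwartz fields. -/

section

variable {d : ℕ}

lemma integral_norm_sq_fourier_toComplex (b : 𝓢(E d, ℝ)) :
    ∫ ξ, ‖(𝓕 (toComplex b)) ξ‖ ^ 2 = ‖toL2 b‖ ^ 2 := by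
  rw [SchwartzMap.integral_norm_sq_fourier, ← real_inner_self_eq_norm_sq, inner_toL2]
  refine integral_congr_ae (.of_forall fun x => ?_)
  simp [toComplex_apply, ← sq]

lemma integrable_norm_sq_schwartz (f : 𝓢(E d, ℂ)) : Integrable (fun x => ‖f x‖ ^ 2) :=
  (memLp_two_iff_integrable_sq_norm f.continuous.aestronglyMeasurable).1 (f.memLp 2)

/-- The squared multiplier is at most `1` on the ball of radius `R` and at most `(1 + R²)⁻¹` outside
it, so high frequencies are uniformly small. -/
lemma norm_resolvent_sq_le_of_radius (b : 𝓢(E d, ℝ)) {R : ℝ} (hR : 0 ≤ R) :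
    ‖toL2 (resolvent b)‖ ^ 2 ≤ (∫ ξ in Metric.closedBall 0 R, ‖(𝓕 (toComplex b)) ξ‖ ^ 2)
      + (1 + R ^ 2)⁻¹ * ‖toL2 b‖ ^ 2 := by
  have hint := integrable_norm_sq_schwartz (𝓕 (toComplex b))
  refine (norm_resolvent_sq_le b).trans ?_
  rw [← integral_norm_sq_fourier_toComplex, ← integral_indicator measurableSet_closedBall,
    ← integral_const_mul, ← integral_add (hint.indicator measurableSet_closedBall)
      (hint.const_mul _)]
  refine integral_mono_of_nonneg (.of_forall fun ξ => sq_nonneg _)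
    ((hint.indicator measurableSet_closedBall).add (hint.const_mul _)) (.of_forall fun ξ => ?_)
  change ((1 + ‖ξ‖ ^ 2)⁻¹ * ‖(𝓕 (toComplex b)) ξ‖) ^ 2 ≤
    (Metric.closedBall 0 R).indicator (fun x => ‖(𝓕 (toComplex b)) x‖ ^ 2) ξ
      + (1 + R ^ 2)⁻¹ * ‖(𝓕 (toComplex b)) ξ‖ ^ 2
  set F : ℝ := ‖(𝓕 (toComplex b)) ξ‖ with hF
  have h0 : (1 + ‖ξ‖ ^ 2)⁻¹ ≤ 1 := inv_le_one_of_one_le₀ (by nlinarith [sq_nonneg ‖ξ‖])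
  have hp : 0 ≤ (1 + ‖ξ‖ ^ 2)⁻¹ := by positivity
  have hF2 : 0 ≤ F ^ 2 := sq_nonneg _
  rw [mul_pow]
  by_cases hξ : ξ ∈ Metric.closedBall (0 : E d) R
  · rw [Set.indicator_of_mem hξ]
    have : 0 ≤ (1 + R ^ 2)⁻¹ * F ^ 2 := by positivity
    have : ((1 + ‖ξ‖ ^ 2)⁻¹) ^ 2 ≤ 1 := pow_le_one₀ hp h0
    nlinarith
  · rw [Set.indicator_of_notMem hξ, zero_add]
    refine mul_le_mul_of_nonneg_right ?_ hF2
    have hlt : R < ‖ξ‖ := by simpa using hξ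
    calc ((1 + ‖ξ‖ ^ 2)⁻¹) ^ 2 ≤ (1 + ‖ξ‖ ^ 2)⁻¹ := by nlinarith
      _ ≤ (1 + R ^ 2)⁻¹ := by gcongr

/-- The resolvent turns boundedness and pointwise convergence of the Fourier transforms into
strong convergence. -/
lemma tendsto_resolvent {b : ℕ → 𝓢(E d, ℝ)} {M : ℝ} (hM : ∀ n, ‖toL2 (b n)‖ ≤ M)
    (hF : ∀ n ξ, ‖(𝓕 (toComplex (b n))) ξ‖ ≤ M)
    (h0 : ∀ ξ, Tendsto (fun n => (𝓕 (toComplex (b n))) ξ) atTop (𝓝 0)) :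
    Tendsto (fun n => ‖toL2 (resolvent (b n))‖) atTop (𝓝 0) := by
  have hM0 : 0 ≤ M := (norm_nonneg _).trans (hM 0)
  have key : Tendsto (fun n => ‖toL2 (resolvent (b n))‖ ^ 2) atTop (𝓝 0) := by
    rw [tendsto_order]
    refine ⟨fun a ha => .of_forall fun n => ha.trans_le (sq_nonneg _), fun ε hε => ?_⟩
    -- The radius makes the high frequencies cost less than `ε / 2` for every `n`; the low ones are
    -- then handled by dominated convergence on a fixed ball.
    obtain ⟨R, hR0, hR⟩ : ∃ R : ℝ, 0 ≤ R ∧ (1 + R ^ 2)⁻¹ * M ^ 2 < ε / 2 := by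
      have : Tendsto (fun R : ℝ => (1 + R ^ 2)⁻¹ * M ^ 2) atTop (𝓝 (0 * M ^ 2)) := by
        refine Tendsto.mul_const _ (tendsto_inv_atTop_zero.comp ?_)
        exact tendsto_atTop_add_const_left _ _ (tendsto_pow_atTop (by norm_num))
      rw [zero_mul] at this
      exact ((eventually_ge_atTop 0).and (this.eventually (gt_mem_nhds (half_pos hε)))).exists
    have hball : Tendsto (fun n => ∫ ξ in Metric.closedBall 0 R, ‖(𝓕 (toComplex (b n))) ξ‖ ^ 2)
        atTop (𝓝 (∫ ξ in Metric.closedBall (0 : E d) R, (0 : ℝ))) := by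
      refine tendsto_integral_of_dominated_convergence (fun _ => M ^ 2) (fun n => ?_) ?_
        (fun n => .of_forall fun ξ => ?_) (.of_forall fun ξ => ?_)
      · exact ((𝓕 (toComplex (b n))).continuous.norm.pow 2).aestronglyMeasurable
      · exact integrableOn_const (measure_closedBall_lt_top.ne)
      · rw [Real.norm_of_nonneg (sq_nonneg _)]
        exact pow_le_pow_left₀ (norm_nonneg _) (hF n ξ) 2
      · simpa using ((h0 ξ).norm.pow 2)
    rw [integral_zero] at hball
    filter_upwards [hball.eventually (gt_mem_nhds (half_pos hε))] with n hn
    have h1 := norm_resolvent_sq_le_of_radius (b n) hR0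
    have h2 : (1 + R ^ 2)⁻¹ * ‖toL2 (b n)‖ ^ 2 ≤ (1 + R ^ 2)⁻¹ * M ^ 2 := by
      gcongr
      exact hM n
    linarith
  have := key.sqrt
  simpa [Real.sqrt_sq (norm_nonneg _)] using this

/-! ### Energy identities -/

lemma inner_helmholtz (u : 𝓢(E d, ℝ)) : ⟪toL2 (helmholtz u), toL2 u⟫
    = ‖toL2 u‖ ^ 2 + ((2 * Real.pi) ^ 2)⁻¹ * ∑ i, ‖toL2 (D i u)‖ ^ 2 := by
  rw [helmholtz_apply, map_sub, map_smul, map_sum, inner_sub_left, inner_smul_left, sum_inner,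
    real_inner_self_eq_norm_sq]
  have : ∀ i, ⟪toL2 (D i (D i u)), toL2 u⟫ = - ‖toL2 (D i u)‖ ^ 2 := by
    intro i
    rw [← real_inner_self_eq_norm_sq, inner_D_right, neg_neg]
  simp [this]

lemma inner_D_D_D_D (i j : Fin d) (u : 𝓢(E d, ℝ)) :
    ⟪toL2 (D i (D i u)), toL2 (D j (D j u))⟫ = ‖toL2 (D i (D j u))‖ ^ 2 := by
  have h : D j (D i (D i u)) = D i (D i (D j u)) := by rw [D_comm j i, D_comm j i]
  rw [← real_inner_self_eq_norm_sq, inner_D_right, h, inner_D_right i (D i (D j u))]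

/-- Integration by parts turns all cross terms into squares with positive coefficients. This is the
elliptic estimate: `helmholtz u` controls every second derivative of `u`, with no boundary terms. -/
lemma norm_helmholtz_sq (u : 𝓢(E d, ℝ)) : ‖toL2 (helmholtz u)‖ ^ 2
    = ‖toL2 u‖ ^ 2 + 2 * ((2 * Real.pi) ^ 2)⁻¹ * ∑ i, ‖toL2 (D i u)‖ ^ 2
      + (((2 * Real.pi) ^ 2)⁻¹) ^ 2 * ∑ i, ∑ j, ‖toL2 (D i (D j u))‖ ^ 2 := by
  have h1 := inner_helmholtz u
  set c : ℝ := ((2 * Real.pi) ^ 2)⁻¹ with hc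
  have h2 : ⟪toL2 (helmholtz u), toL2 (∑ i, D i (D i u))⟫
      = - (∑ i, ‖toL2 (D i u)‖ ^ 2) - c * ∑ i, ∑ j, ‖toL2 (D i (D j u))‖ ^ 2 := by
    rw [helmholtz_apply, ← hc, map_sub, map_smul, inner_sub_left, inner_smul_left]
    congr 1
    · rw [map_sum, inner_sum, ← Finset.sum_neg_distrib]
      refine Finset.sum_congr rfl fun i _ => ?_
      rw [inner_D_right, real_inner_self_eq_norm_sq]
    · congr 1
      rw [map_sum, sum_inner]
      refine Finset.sum_congr rfl fun i _ => ?_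
      rw [inner_sum]
      refine Finset.sum_congr rfl fun j _ => ?_
      exact inner_D_D_D_D i j u
  have h3 : ⟪toL2 (helmholtz u), toL2 (helmholtz u)⟫ = ⟪toL2 (helmholtz u), toL2 u⟫
      - c * ⟪toL2 (helmholtz u), toL2 (∑ i, D i (D i u))⟫ := by
    rw [← inner_smul_right, ← inner_sub_right, ← map_smul, ← map_sub, hc, ← helmholtz_apply]
  rw [← real_inner_self_eq_norm_sq, h3, h1, h2]
  ring

lemma single_le_sum_sum {ι κ : Type*} [Fintype ι] [Fintype κ] {f : ι → κ → ℝ}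
    (hf : ∀ i j, 0 ≤ f i j) (i : ι) (j : κ) : f i j ≤ ∑ i, ∑ j, f i j :=
  (Finset.single_le_sum (fun j _ => hf i j) (Finset.mem_univ j)).trans
    (Finset.single_le_sum (f := fun i => ∑ j, f i j)
      (fun i _ => Finset.sum_nonneg fun j _ => hf i j) (Finset.mem_univ i))

lemma norm_D_D_le (i j : Fin d) (u : 𝓢(E d, ℝ)) :
    ‖toL2 (D i (D j u))‖ ≤ (2 * Real.pi) ^ 2 * ‖toL2 (helmholtz u)‖ := by
  have h := norm_helmholtz_sq u
  have hpi : (0 : ℝ) < (2 * Real.pi) ^ 2 := by positivity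
  have h1 : 0 ≤ 2 * ((2 * Real.pi) ^ 2)⁻¹ * ∑ i, ‖toL2 (D i u)‖ ^ 2 :=
    mul_nonneg (by positivity) (Finset.sum_nonneg fun _ _ => sq_nonneg _)
  have h2 : ‖toL2 (D i (D j u))‖ ^ 2 ≤ ∑ i, ∑ j, ‖toL2 (D i (D j u))‖ ^ 2 :=
    single_le_sum_sum (f := fun i j => ‖toL2 (D i (D j u))‖ ^ 2) (fun _ _ => sq_nonneg _) i j
  have h3 : (((2 * Real.pi) ^ 2)⁻¹ * ‖toL2 (D i (D j u))‖) ^ 2 ≤ ‖toL2 (helmholtz u)‖ ^ 2 := by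
    rw [mul_pow, h]
    have h5 := mul_le_mul_of_nonneg_left h2 (sq_nonneg (((2 * Real.pi) ^ 2)⁻¹))
    have h6 := sq_nonneg ‖toL2 u‖
    linarith
  have h4 := (pow_le_pow_iff_left₀ (by positivity) (norm_nonneg _) two_ne_zero).1 h3
  rwa [inv_mul_le_iff₀ hpi] at h4

/-- Interpolation from the energy identity: if `helmholtz u` stays bounded while `u` tends to zero
in `L²`, the gradient tends to zero too. -/
lemma norm_D_sq_le (i : Fin d) (u : 𝓢(E d, ℝ)) :
    ‖toL2 (D i u)‖ ^ 2 ≤ (2 * Real.pi) ^ 2 * (‖toL2 (helmholtz u)‖ * ‖toL2 u‖) := by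
  have h := inner_helmholtz u
  have hpi : (0 : ℝ) < (2 * Real.pi) ^ 2 := by positivity
  have h1 := real_inner_le_norm (toL2 (helmholtz u)) (toL2 u)
  have h2 : ‖toL2 (D i u)‖ ^ 2 ≤ ∑ i, ‖toL2 (D i u)‖ ^ 2 :=
    Finset.single_le_sum (f := fun i => ‖toL2 (D i u)‖ ^ 2) (fun _ _ => sq_nonneg _)
      (Finset.mem_univ i)
  rw [← inv_mul_le_iff₀ hpi]
  have h3 := mul_le_mul_of_nonneg_left h2 (inv_nonneg.2 hpi.le)
  have h4 := sq_nonneg ‖toL2 u‖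
  linarith

lemma inner_helmholtz_comm (f g : 𝓢(E d, ℝ)) :
    ⟪toL2 (helmholtz f), toL2 g⟫ = ⟪toL2 f, toL2 (helmholtz g)⟫ := by
  simp only [helmholtz_apply, map_sub, map_smul, map_sum, inner_sub_left, inner_sub_right,
    inner_smul_left, inner_smul_right, sum_inner, inner_sum, inner_D_D]
  simp

lemma helmholtz_D (i : Fin d) (f : 𝓢(E d, ℝ)) : helmholtz (D i f) = D i (helmholtz f) := by
  simp only [helmholtz_apply, map_sub, map_smul, map_sum]
  congr 2
  refine Finset.sum_congr rfl fun j _ => ?_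
  rw [D_comm j i, D_comm j i]

/-- `helmholtz` and `∂_k∂_m` are symmetric and commute. Applied to potentials, this moves the
resolvent from one factor of a product to the other. -/
lemma inner_helmholtz_D_D (k m : Fin d) (p u : 𝓢(E d, ℝ)) :
    ⟪toL2 (helmholtz p), toL2 (D k (D m u))⟫ = ⟪toL2 (helmholtz u), toL2 (D k (D m p))⟫ := by
  rw [inner_D_D, ← helmholtz_D, ← helmholtz_D, inner_helmholtz_comm, real_inner_comm]

/-! ### The curl-curl lemma for sequences of Schwartz fields -/

/-- The curl of the fields `a n` converges to zero in a dual Sobolev norm: it does so when tested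
against sequences that are bounded in `H¹` and converge to zero in `L²`. -/
def CurlNull (a : ℕ → Fin d → 𝓢(E d, ℝ)) : Prop :=
  ∀ (η : ℕ → 𝓢(E d, ℝ)) (M : ℝ), (∀ n i, ‖toL2 (D i (η n))‖ ≤ M) →
    Tendsto (fun n => ‖toL2 (η n)‖) atTop (𝓝 0) → ∀ k l,
    Tendsto (fun n => ⟪toL2 (a n l), toL2 (D k (η n))⟫ - ⟪toL2 (a n k), toL2 (D l (η n))⟫)
      atTop (𝓝 0)

/-- The fields `a n` are bounded in `L²`, and compactness of the resolvent makes their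
potentials converge to zero. -/
structure ResolventNull (a : ℕ → Fin d → 𝓢(E d, ℝ)) : Prop where
  bounded : ∃ M, ∀ n k, ‖toL2 (a n k)‖ ≤ M
  tendsto : ∀ k, Tendsto (fun n => ‖toL2 (resolvent (a n k))‖) atTop (𝓝 0)

lemma ResolventNull.tendsto_D {a : ℕ → Fin d → 𝓢(E d, ℝ)} (ha : ResolventNull a) (i k : Fin d) :
    Tendsto (fun n => ‖toL2 (D i (resolvent (a n k)))‖) atTop (𝓝 0) := by
  obtain ⟨M, hM⟩ := ha.bounded
  have h : Tendsto (fun n => ‖toL2 (D i (resolvent (a n k)))‖ ^ 2) atTop (𝓝 0) := by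
    have h1 := ((ha.tendsto k).const_mul M).const_mul ((2 * Real.pi) ^ 2)
    rw [mul_zero, mul_zero] at h1
    refine squeeze_zero (fun n => sq_nonneg _) (fun n => ?_) h1
    refine (norm_D_sq_le i _).trans ?_
    rw [helmholtz_resolvent]
    gcongr
    exact hM n k
  simpa [Real.sqrt_sq (norm_nonneg _)] using h.sqrt

/-- First derivatives of the potentials of `b` are admissible tests for the curl of `a`: their
gradients are bounded by the elliptic estimate and they vanish in `L²` by interpolation. -/
lemma CurlNull.tendsto_resolvent {a b : ℕ → Fin d → 𝓢(E d, ℝ)} (ha : CurlNull a)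
    (hb : ResolventNull b) (i j k l : Fin d) :
    Tendsto (fun n => ⟪toL2 (a n l), toL2 (D k (D i (resolvent (b n j))))⟫
      - ⟪toL2 (a n k), toL2 (D l (D i (resolvent (b n j))))⟫) atTop (𝓝 0) := by
  obtain ⟨M, hM⟩ := hb.bounded
  refine ha (fun n => D i (resolvent (b n j))) ((2 * Real.pi) ^ 2 * M) (fun n m => ?_)
    (hb.tendsto_D i j) k l
  refine (norm_D_D_le _ _ _).trans ?_
  rw [helmholtz_resolvent]
  gcongr
  exact hM n j

/-- Moving the second derivatives of the potential of `b` from the direction `m` to `k`. -/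
lemma tendsto_inner_add_sum {a b : ℕ → Fin d → 𝓢(E d, ℝ)} (ha : CurlNull a)
    (ha' : ResolventNull a) (hb : ResolventNull b) (k l : Fin d) :
    Tendsto (fun n => ⟪toL2 (a n k), toL2 (b n l)⟫ + ((2 * Real.pi) ^ 2)⁻¹ *
      ∑ m, ⟪toL2 (b n l), toL2 (D k (D m (resolvent (a n m))))⟫) atTop (𝓝 0) := by
  obtain ⟨M, hM⟩ := ha'.bounded
  set c : ℝ := ((2 * Real.pi) ^ 2)⁻¹ with hc
  have h1 : Tendsto (fun n => ⟪toL2 (a n k), toL2 (resolvent (b n l))⟫) atTop (𝓝 0) := by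
    have := (hb.tendsto l).const_mul M
    rw [mul_zero] at this
    refine squeeze_zero_norm (fun n => (norm_inner_le_norm _ _).trans ?_) this
    gcongr
    exact hM n k
  -- The null curl of `a` exchanges `⟪a_k, ∂_m∂_m r(b_l)⟫` for `⟪a_m, ∂_k∂_m r(b_l)⟫`.
  have h2 := (tendsto_finsetSum Finset.univ fun m _ =>
    ha.tendsto_resolvent hb m l m k).const_mul c
  have h3 := h1.sub h2
  simp only [Finset.sum_const_zero, mul_zero, sub_zero] at h3
  refine h3.congr fun n => ?_
  have h4 : ∀ m, ⟪toL2 (b n l), toL2 (D k (D m (resolvent (a n m))))⟫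
      = ⟪toL2 (a n m), toL2 (D k (D m (resolvent (b n l))))⟫ := by
    intro m
    have := inner_helmholtz_D_D k m (resolvent (a n m)) (resolvent (b n l))
    rw [helmholtz_resolvent, helmholtz_resolvent] at this
    exact this.symm
  have h5 : ⟪toL2 (a n k), toL2 (b n l)⟫ = ⟪toL2 (a n k), toL2 (resolvent (b n l))⟫
      - c * ∑ m, ⟪toL2 (a n k), toL2 (D m (D m (resolvent (b n l))))⟫ := by
    conv_lhs => rw [← helmholtz_resolvent (b n l), helmholtz_apply]
    rw [map_sub, map_smul, map_sum, inner_sub_right, inner_smul_right, inner_sum]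
  rw [h5]
  simp only [h4, Finset.sum_sub_distrib]
  ring

/-- Once both products are rewritten with the potentials of `a`, their difference is a sum of curls
of `b` tested against `∂_m r(a_m)`. -/
theorem tendsto_inner_sub_inner {a b : ℕ → Fin d → 𝓢(E d, ℝ)} (ha : CurlNull a)
    (ha' : ResolventNull a) (hb : CurlNull b) (hb' : ResolventNull b) (k l : Fin d) :
    Tendsto (fun n => ⟪toL2 (a n k), toL2 (b n l)⟫ - ⟪toL2 (a n l), toL2 (b n k)⟫)
      atTop (𝓝 0) := by
  have h1 := (tendsto_inner_add_sum ha ha' hb' k l).sub (tendsto_inner_add_sum ha ha' hb' l k)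
  have h2 := (tendsto_finsetSum Finset.univ fun m _ =>
    hb.tendsto_resolvent ha' m m k l).const_mul (((2 * Real.pi) ^ 2)⁻¹)
  have h3 := h1.sub h2
  simp only [Finset.sum_const_zero, mul_zero, sub_zero] at h3
  refine h3.congr fun n => ?_
  simp only [Finset.sum_sub_distrib]
  ring

end

/-! ### Localization of weakly null fields on `Ω`. -/

section

variable {d : ℕ}

/-! ### Products of Schwartz functions -/

/-- The product of two Schwartz functions. -/
def mulS (χ f : 𝓢(E d, ℝ)) : 𝓢(E d, ℝ) := SchwartzMap.pairing (ContinuousLinearMap.mul ℝ ℝ) χ f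

lemma mulS_apply (χ f : 𝓢(E d, ℝ)) (x : E d) : mulS χ f x = χ x * f x := rfl

lemma D_mulS (i : Fin d) (χ f : 𝓢(E d, ℝ)) :
    D i (mulS χ f) = mulS (D i χ) f + mulS χ (D i f) := by
  ext x
  change fderiv ℝ (fun y => χ y * f y) x (e i) = fderiv ℝ χ x (e i) * f x + χ x * fderiv ℝ f x (e i)
  rw [fderiv_fun_mul χ.differentiableAt f.differentiableAt]
  simp
  ring

lemma tsupport_mulS_subset (χ f : 𝓢(E d, ℝ)) : tsupport (mulS χ f) ⊆ tsupport χ :=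
  tsupport_mul_subset_left (f := χ) (g := f)

lemma norm_toL2_le_of_abs_le {f g : 𝓢(E d, ℝ)} {C : ℝ} (h : ∀ x, |f x| ≤ C * |g x|) :
    ‖toL2 f‖ ≤ C * ‖toL2 g‖ := by
  refine Lp.norm_le_mul_norm_of_ae_le_mul ?_
  filter_upwards [coeFn_toL2 f, coeFn_toL2 g] with x hf hg
  rw [hf, hg]
  exact h x

lemma exists_bound (χ : 𝓢(E d, ℝ)) : ∃ C, 0 ≤ C ∧ ∀ x, |χ x| ≤ C := by
  obtain ⟨C, hC, h⟩ := χ.decay 0 0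
  exact ⟨C, hC.le, fun x => by simpa using h x⟩

lemma exists_norm_mulS_le (χ : 𝓢(E d, ℝ)) :
    ∃ C, 0 ≤ C ∧ ∀ f, ‖toL2 (mulS χ f)‖ ≤ C * ‖toL2 f‖ := by
  obtain ⟨C, hC, h⟩ := exists_bound χ
  refine ⟨C, hC, fun f => norm_toL2_le_of_abs_le fun x => ?_⟩
  rw [mulS_apply, abs_mul]
  gcongr
  exact h x

lemma inner_mulS (χ f g : 𝓢(E d, ℝ)) :
    ⟪toL2 (mulS χ f), toL2 g⟫ = ⟪toL2 f, toL2 (mulS χ g)⟫ := by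
  rw [inner_toL2, inner_toL2]
  refine integral_congr_ae (.of_forall fun x => ?_)
  simp only [mulS_apply]
  ring

lemma exists_schwartz_norm_sub_le (v : L2 d) {ε : ℝ} (hε : 0 < ε) :
    ∃ s : 𝓢(E d, ℝ), ‖v - toL2 s‖ ≤ ε := by
  have h : DenseRange (toL2 (d := d)) := SchwartzMap.denseRange_toLpCLM (by simp)
  obtain ⟨s, hs⟩ := h.exists_dist_lt v hε
  exact ⟨s, by rw [← dist_eq_norm]; exact hs.le⟩

/-! ### Fourier transform of a localized function -/

/-- The product of a compactly supported Schwartz function with a smooth function. -/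
def mulSmooth (χ : 𝓢(E d, ℝ)) (hχ : HasCompactSupport χ) (g : E d → ℝ) (hg : ContDiff ℝ ∞ g) :
    𝓢(E d, ℝ) :=
  (hχ.mul_right (f' := g)).toSchwartzMap ((χ.smooth ⊤).mul hg)

lemma mulSmooth_apply (χ : 𝓢(E d, ℝ)) (hχ : HasCompactSupport χ) (g : E d → ℝ)
    (hg : ContDiff ℝ ∞ g) (x : E d) : mulSmooth χ hχ g hg x = χ x * g x := rfl

lemma norm_mulSmooth_le (χ : 𝓢(E d, ℝ)) (hχ : HasCompactSupport χ) (g : E d → ℝ)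
    (hg : ContDiff ℝ ∞ g) (h1 : ∀ x, |g x| ≤ 1) : ‖toL2 (mulSmooth χ hχ g hg)‖ ≤ ‖toL2 χ‖ := by
  rw [← one_mul ‖toL2 χ‖]
  refine norm_toL2_le_of_abs_le fun x => ?_
  rw [mulSmooth_apply, abs_mul, one_mul]
  exact mul_le_of_le_one_right (abs_nonneg _) (h1 x)

lemma contDiff_cos_inner (ξ : E d) :
    ContDiff ℝ ∞ (fun x : E d => Real.cos (2 * Real.pi * ⟪x, ξ⟫)) :=
  Real.contDiff_cos.comp (contDiff_const.mul (contDiff_id.inner ℝ contDiff_const))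

lemma contDiff_sin_inner (ξ : E d) :
    ContDiff ℝ ∞ (fun x : E d => Real.sin (2 * Real.pi * ⟪x, ξ⟫)) :=
  Real.contDiff_sin.comp (contDiff_const.mul (contDiff_id.inner ℝ contDiff_const))

/-- Because `χ` has compact support, `χ cos` and `χ sin` are fixed elements of `L²` for each
frequency. Weak convergence of `s` thus becomes pointwise convergence of the transforms, with a
bound uniform in `ξ`. -/
lemma norm_fourier_mulS_le (χ : 𝓢(E d, ℝ)) (hχ : HasCompactSupport χ) (s : 𝓢(E d, ℝ)) (ξ : E d) :
    ‖(𝓕 (toComplex (mulS χ s))) ξ‖ ≤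
      |⟪toL2 s, toL2 (mulSmooth χ hχ _ (contDiff_cos_inner ξ))⟫|
      + |⟪toL2 s, toL2 (mulSmooth χ hχ _ (contDiff_sin_inner ξ))⟫| := by
  have hint : Integrable (fun x => Real.fourierChar (-⟪x, ξ⟫) • toComplex (mulS χ s) x) := by
    have := (Real.fourierIntegral_convergent_iff (μ := volume) ξ).2
      (toComplex (mulS χ s)).integrable
    exact this
  have hF : (𝓕 (toComplex (mulS χ s))) ξ
      = ∫ x, Real.fourierChar (-⟪x, ξ⟫) • toComplex (mulS χ s) x := by
    rw [SchwartzMap.fourier_coe, Real.fourier_eq]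
  have hch : ∀ x, Real.fourierChar (-⟪x, ξ⟫) • toComplex (mulS χ s) x
      = Complex.exp (((- (2 * Real.pi * ⟪x, ξ⟫) : ℝ) : ℂ) * Complex.I) * ((χ x * s x : ℝ) : ℂ) := by
    intro x
    rw [Circle.smul_def, Real.fourierChar_apply, smul_eq_mul, toComplex_apply, mulS_apply]
    congr 3
    push_cast
    ring
  refine (Complex.norm_le_abs_re_add_abs_im _).trans (le_of_eq ?_)
  congr 1
  · congr 1
    rw [hF, ← Complex.reCLM_apply, ← Complex.reCLM.integral_comp_comm hint, inner_toL2]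
    refine integral_congr_ae (.of_forall fun x => ?_)
    simp only [hch, Complex.reCLM_apply, Complex.re_mul_ofReal, Complex.exp_ofReal_mul_I_re,
      mulSmooth_apply, Real.cos_neg]
    ring
  · rw [hF, ← Complex.imCLM_apply, ← Complex.imCLM.integral_comp_comm hint, inner_toL2, ← abs_neg,
      ← integral_neg]
    congr 1
    refine integral_congr_ae (.of_forall fun x => ?_)
    simp only [hch, Complex.imCLM_apply, Complex.im_mul_ofReal, Complex.exp_ofReal_mul_I_im,
      mulSmooth_apply, Real.sin_neg]
    ring

/-! ### Localization -/

/-- Sequences of test functions with supports in a common compact subset of `Ω` that are bounded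
in `H¹` and converge to zero in `L²`. -/
structure NullTestSeq (Ω : Opens (E d)) (ψ : ℕ → 𝓢(E d, ℝ)) : Prop where
  support : ∃ K : Set (E d), IsCompact K ∧ K ⊆ Ω ∧ ∀ n, tsupport (ψ n) ⊆ K
  bounded : ∃ M, ∀ n i, ‖toL2 (D i (ψ n))‖ ≤ M
  tendsto : Tendsto (fun n => ‖toL2 (ψ n)‖) atTop (𝓝 0)

/-- The curl of the fields `v n` on `Ω` converges to zero in `H⁻¹_loc`, when tested against
sequences of test functions. -/
def CurlNullOn (Ω : Opens (E d)) (v : ℕ → Fin d → L2 d) : Prop :=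
  ∀ ψ, NullTestSeq Ω ψ → ∀ k l,
    Tendsto (fun n => ⟪v n l, toL2 (D k (ψ n))⟫ - ⟪v n k, toL2 (D l (ψ n))⟫) atTop (𝓝 0)

/-- The fields `v n` are bounded in `L²`, converge weakly to zero, and their curls on `Ω` converge
to zero in `H⁻¹_loc`. -/
structure WeaklyNull (Ω : Opens (E d)) (v : ℕ → Fin d → L2 d) : Prop where
  bounded : ∃ M, ∀ n k, ‖v n k‖ ≤ M
  tendsto : ∀ k (f : L2 d), Tendsto (fun n => ⟪v n k, f⟫) atTop (𝓝 0)
  curl : CurlNullOn Ω v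

lemma nullTestSeq_mulS {Ω : Opens (E d)} {χ : 𝓢(E d, ℝ)} (hχ : HasCompactSupport χ)
    (hχΩ : tsupport χ ⊆ Ω) {η : ℕ → 𝓢(E d, ℝ)} {M : ℝ} (hM : ∀ n i, ‖toL2 (D i (η n))‖ ≤ M)
    (h0 : Tendsto (fun n => ‖toL2 (η n)‖) atTop (𝓝 0)) :
    NullTestSeq Ω (fun n => mulS χ (η n)) := by
  obtain ⟨C, hC, hCb⟩ := exists_norm_mulS_le χ
  refine ⟨⟨tsupport χ, hχ, hχΩ, fun n => tsupport_mulS_subset χ _⟩, ?_, ?_⟩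
  · choose C' hC' hCb' using fun i => exists_norm_mulS_le (D i χ)
    obtain ⟨B, hB⟩ := h0.bddAbove_range
    have hB' : ∀ n, ‖toL2 (η n)‖ ≤ B := fun n => hB ⟨n, rfl⟩
    have hB0 : 0 ≤ B := (norm_nonneg _).trans (hB' 0)
    refine ⟨(∑ i, C' i) * B + C * M, fun n i => ?_⟩
    rw [D_mulS, map_add]
    refine (norm_add_le _ _).trans (add_le_add ((hCb' i _).trans ?_) ((hCb _).trans ?_))
    · gcongr
      · exact Finset.sum_nonneg fun i _ => hC' i
      · exact Finset.single_le_sum (fun i _ => hC' i) (Finset.mem_univ i)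
      · exact hB' n
    · gcongr
      exact hM n i
  · have := h0.const_mul C
    rw [mul_zero] at this
    exact squeeze_zero (fun n => norm_nonneg _) (fun n => hCb _) this

lemma tendsto_inner_of_norm_sub {u v : ℕ → L2 d} {f : ℕ → L2 d} {M c : ℝ}
    (huv : Tendsto (fun n => ‖u n - v n‖) atTop (𝓝 0)) (hf : ∀ n, ‖f n‖ ≤ M)
    (h : Tendsto (fun n => ⟪u n, f n⟫) atTop (𝓝 c)) :
    Tendsto (fun n => ⟪v n, f n⟫) atTop (𝓝 c) := by
  have h1 : Tendsto (fun n => ⟪u n - v n, f n⟫) atTop (𝓝 0) := by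
    have := huv.mul_const M
    rw [zero_mul] at this
    refine squeeze_zero_norm (fun n => (norm_inner_le_norm _ _).trans ?_) this
    gcongr
    exact hf n
  have h2 := h.sub h1
  rw [sub_zero] at h2
  refine h2.congr fun n => ?_
  rw [inner_sub_left]
  ring

section Localize

variable {Ω : Opens (E d)} {v : ℕ → Fin d → L2 d} {χ : 𝓢(E d, ℝ)} {s : ℕ → Fin d → 𝓢(E d, ℝ)}

lemma WeaklyNull.bounded_approx (hv : WeaklyNull Ω v)
    (hs : ∀ n k, ‖v n k - toL2 (s n k)‖ ≤ 1 / ((n : ℝ) + 1)) :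
    ∃ M, 0 ≤ M ∧ ∀ n k, ‖toL2 (s n k)‖ ≤ M := by
  obtain ⟨M, hM⟩ := hv.bounded
  refine ⟨|M| + 1, by positivity, fun n k => ?_⟩
  have h1 : 1 / ((n : ℝ) + 1) ≤ 1 := by
    rw [div_le_one (by positivity)]
    linarith [(Nat.cast_nonneg n : (0 : ℝ) ≤ n)]
  calc ‖toL2 (s n k)‖ = ‖v n k - (v n k - toL2 (s n k))‖ := by rw [sub_sub_cancel]
    _ ≤ ‖v n k‖ + ‖v n k - toL2 (s n k)‖ := norm_sub_le _ _
    _ ≤ |M| + 1 := add_le_add ((hM n k).trans (le_abs_self M)) ((hs n k).trans h1)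

lemma tendsto_norm_sub_of_le (hs : ∀ n k, ‖v n k - toL2 (s n k)‖ ≤ 1 / ((n : ℝ) + 1))
    (k : Fin d) : Tendsto (fun n => ‖v n k - toL2 (s n k)‖) atTop (𝓝 0) :=
  squeeze_zero (fun _ => norm_nonneg _) (fun n => hs n k) tendsto_one_div_add_atTop_nhds_zero_nat

/-- This plays the role of Rellich's theorem: the cutoff makes the Fourier transforms bounded and
pointwise null. The Schwartz approximants `s` have vanishing error, so they share the weak limit of
`v`. -/
lemma WeaklyNull.resolventNull (hv : WeaklyNull Ω v) (hχ : HasCompactSupport χ)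
    (hs : ∀ n k, ‖v n k - toL2 (s n k)‖ ≤ 1 / ((n : ℝ) + 1)) :
    ResolventNull (fun n k => mulS χ (s n k)) := by
  obtain ⟨M, hM0, hM⟩ := hv.bounded_approx hs
  obtain ⟨C, hC, hCb⟩ := exists_norm_mulS_le χ
  have hbd : ∀ n k, ‖toL2 (mulS χ (s n k))‖ ≤ C * M := fun n k =>
    (hCb _).trans (by gcongr; exact hM n k)
  refine ⟨⟨_, hbd⟩, fun k => ?_⟩
  have hin : ∀ (n : ℕ) (g : E d → ℝ) (hg : ContDiff ℝ ∞ g), (∀ x, |g x| ≤ 1) →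
      |⟪toL2 (s n k), toL2 (mulSmooth χ hχ g hg)⟫| ≤ M * ‖toL2 χ‖ := by
    intro n g hg h1
    refine (abs_real_inner_le_norm _ _).trans ?_
    gcongr
    · exact hM n k
    · exact norm_mulSmooth_le χ hχ g hg h1
  have hte : ∀ (g : E d → ℝ) (hg : ContDiff ℝ ∞ g),
      Tendsto (fun n => |⟪toL2 (s n k), toL2 (mulSmooth χ hχ g hg)⟫|) atTop (𝓝 0) := by
    intro g hg
    have := tendsto_inner_of_norm_sub (tendsto_norm_sub_of_le hs k) (fun _ => le_rfl)
      (hv.tendsto k (toL2 (mulSmooth χ hχ g hg)))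
    simpa using this.abs
  refine GaussCodazziRicci.tendsto_resolvent (M := max (C * M) (M * ‖toL2 χ‖ + M * ‖toL2 χ‖))
    (fun n => (hbd n k).trans (le_max_left _ _)) (fun n ξ => ?_) (fun ξ => ?_)
  · refine ((norm_fourier_mulS_le χ hχ _ ξ).trans ?_).trans (le_max_right _ _)
    exact add_le_add (hin n _ _ fun x => Real.abs_cos_le_one _)
      (hin n _ _ fun x => Real.abs_sin_le_one _)
  · refine squeeze_zero_norm (fun n => norm_fourier_mulS_le χ hχ _ ξ) ?_
    simpa using (hte _ (contDiff_cos_inner ξ)).add (hte _ (contDiff_sin_inner ξ))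

/-- By Leibniz, `χ ∂η = ∂(χη) - (∂χ)η`. The functions `χη` form a null test sequence in `Ω`, seen by
the curl of `v`; the term `(∂χ)η` vanishes with `η` in `L²`. -/
lemma WeaklyNull.curlNull (hv : WeaklyNull Ω v) (hχ : HasCompactSupport χ)
    (hχΩ : tsupport χ ⊆ Ω) (hs : ∀ n k, ‖v n k - toL2 (s n k)‖ ≤ 1 / ((n : ℝ) + 1)) :
    CurlNull (fun n k => mulS χ (s n k)) := by
  intro η M hM h0 k l
  obtain ⟨C, hC, hCb⟩ := exists_norm_mulS_le χ
  obtain ⟨A, hA⟩ := hv.bounded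
  have hcurl := hv.curl _ (nullTestSeq_mulS hχ hχΩ hM h0) k l
  have hlow : ∀ i j, Tendsto (fun n => ⟪v n i, toL2 (mulS (D j χ) (η n))⟫) atTop (𝓝 0) := by
    intro i j
    obtain ⟨C', hC', hCb'⟩ := exists_norm_mulS_le (D j χ)
    have := (h0.const_mul C').const_mul A
    rw [mul_zero, mul_zero] at this
    refine squeeze_zero_norm (fun n => (norm_inner_le_norm _ _).trans ?_) this
    gcongr
    · exact (norm_nonneg _).trans (hA n i)
    · exact hA n i
    · exact hCb' _
  have happ : ∀ i j, Tendsto (fun n => ⟪toL2 (s n i) - v n i, toL2 (mulS χ (D j (η n)))⟫)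
      atTop (𝓝 0) := by
    intro i j
    have := (tendsto_norm_sub_of_le hs i).mul_const (C * M)
    rw [zero_mul] at this
    refine squeeze_zero_norm (fun n => (norm_inner_le_norm _ _).trans ?_) this
    rw [norm_sub_rev]
    gcongr
    exact (hCb _).trans (by gcongr; exact hM n j)
  have := ((hcurl.sub ((hlow l k).sub (hlow k l))).add ((happ l k).sub (happ k l)))
  simp only [sub_zero, add_zero] at this
  refine this.congr fun n => ?_
  simp only [inner_mulS, D_mulS, map_add, inner_add_right, inner_sub_left]
  ring

end Localize

/-! ### The curl-curl lemma, localized, for weakly null sequences -/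

/-- The trilinear form `∫ φ v w`. -/
def tri (φ : E d → ℝ) (v w : L2 d) : ℝ := ∫ x, φ x * (v x * w x)

lemma integrable_mul_L2 (v w : L2 d) : Integrable (fun x => v x * w x) :=
  (Lp.memLp v).integrable_mul (Lp.memLp w)

lemma integrable_tri {φ : E d → ℝ} (hφ : Continuous φ) {C : ℝ} (hC : ∀ x, |φ x| ≤ C)
    (v w : L2 d) : Integrable (fun x => φ x * (v x * w x)) :=
  (integrable_mul_L2 v w).bdd_mul hφ.aestronglyMeasurable (.of_forall hC)

lemma abs_tri_le {φ : E d → ℝ} {C : ℝ} (hC : ∀ x, |φ x| ≤ C) (v w : L2 d) :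
    |tri φ v w| ≤ C * (‖v‖ * ‖w‖) := by
  have hC0 : 0 ≤ C := (abs_nonneg _).trans (hC 0)
  have h1 : |tri φ v w| ≤ ∫ x, C * (|v x| * |w x|) := by
    change ‖∫ x, φ x * (v x * w x)‖ ≤ _
    refine norm_integral_le_of_norm_le ?_ (.of_forall fun x => ?_)
    · have := (integrable_mul_L2 v w).abs.const_mul C
      simpa only [abs_mul] using this
    · rw [Real.norm_eq_abs, abs_mul, abs_mul]
      gcongr
      exact hC x
  have h2 : ∫ x, |v x| * |w x| = ⟪|v|, |w|⟫ := by
    rw [L2.inner_def]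
    refine integral_congr_ae ?_
    filter_upwards [Lp.coeFn_abs v, Lp.coeFn_abs w] with x hv hw
    rw [hv, hw]
    simp [mul_comm]
  rw [integral_const_mul, h2] at h1
  refine h1.trans ?_
  gcongr
  refine (real_inner_le_norm _ _).trans (le_of_eq ?_)
  rw [norm_abs_eq_norm, norm_abs_eq_norm]

lemma tri_sub_left {φ : E d → ℝ} (hφ : Continuous φ) {C : ℝ} (hC : ∀ x, |φ x| ≤ C)
    (u v w : L2 d) : tri φ (u - v) w = tri φ u w - tri φ v w := by
  rw [tri, tri, tri, ← integral_sub (integrable_tri hφ hC _ _) (integrable_tri hφ hC _ _)]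
  refine integral_congr_ae ?_
  filter_upwards [Lp.coeFn_sub u v] with x hx
  rw [hx, Pi.sub_apply]
  ring

lemma tri_comm (φ : E d → ℝ) (v w : L2 d) : tri φ v w = tri φ w v := by
  simp only [tri, mul_comm]

lemma tri_sub_right {φ : E d → ℝ} (hφ : Continuous φ) {C : ℝ} (hC : ∀ x, |φ x| ≤ C)
    (u v w : L2 d) : tri φ w (u - v) = tri φ w u - tri φ w v := by
  rw [tri_comm, tri_sub_left hφ hC, tri_comm φ u, tri_comm φ v]

lemma tri_toL2 (φ f g : 𝓢(E d, ℝ)) : tri φ (toL2 f) (toL2 g) = ⟪toL2 f, toL2 (mulS φ g)⟫ := by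
  rw [inner_toL2, tri]
  refine integral_congr_ae ?_
  filter_upwards [coeFn_toL2 f, coeFn_toL2 g] with x hf hg
  rw [hf, hg, mulS_apply]
  ring

lemma exists_cutoff {Ω : Opens (E d)} {K : Set (E d)} (hK : IsCompact K) (hKΩ : K ⊆ Ω) :
    ∃ χ : 𝓢(E d, ℝ), HasCompactSupport χ ∧ tsupport χ ⊆ Ω ∧ (∀ x ∈ K, χ x = 1) ∧
      ∀ x, χ x ∈ Set.Icc 0 1 := by
  obtain ⟨L, hL, hKL, hLΩ⟩ := exists_compact_between hK Ω.isOpen hKΩ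
  obtain ⟨f, h1, h0, h01⟩ := exists_contMDiffMap_one_nhds_of_subset_interior (n := ⊤)
    𝓘(ℝ, E d) hK.isClosed hKL
  have hsub : tsupport f ⊆ L := by
    refine closure_minimal (fun x hx => ?_) hL.isClosed
    by_contra hxL
    exact hx (h0 x hxL)
  have hc : HasCompactSupport f := hL.of_isClosed_subset (isClosed_tsupport _) hsub
  refine ⟨hc.toSchwartzMap f.contMDiff.contDiff, hc, hsub.trans hLΩ, fun x hx => ?_, h01⟩
  exact h1.self_of_nhdsSet x hx

theorem WeaklyNull.tendsto_tri {Ω : Opens (E d)} {v w : ℕ → Fin d → L2 d} (hv : WeaklyNull Ω v)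
    (hw : WeaklyNull Ω w) {φ : 𝓢(E d, ℝ)} (hφ : HasCompactSupport φ) (hφΩ : tsupport φ ⊆ Ω)
    (k l : Fin d) :
    Tendsto (fun n => tri φ (v n k) (w n l) - tri φ (v n l) (w n k)) atTop (𝓝 0) := by
  obtain ⟨χ, hχ, hχΩ, hχ1, -⟩ := exists_cutoff hφ hφΩ
  have hpos : ∀ n : ℕ, (0 : ℝ) < 1 / ((n : ℝ) + 1) := fun n => by positivity
  choose s hs using fun n k => exists_schwartz_norm_sub_le (v n k) (hpos n)
  choose t ht using fun n k => exists_schwartz_norm_sub_le (w n k) (hpos n)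
  have hmain := tendsto_inner_sub_inner (hv.curlNull hχ hχΩ hs) (hv.resolventNull hχ hs)
    (hw.curlNull hφ hφΩ ht) (hw.resolventNull hφ ht) k l
  -- The weight is carried by `w` as `φ w`, and `v` is only cut off by `χ`; as `χ = 1` on the
  -- support of `φ`, the product is exactly `φ v w`.
  have hχφ : ∀ f, mulS χ (mulS φ f) = mulS φ f := by
    intro f
    ext x
    simp only [mulS_apply]
    by_cases hx : x ∈ tsupport φ
    · rw [hχ1 x hx, one_mul]
    · rw [image_eq_zero_of_notMem_tsupport hx]
      ring
  obtain ⟨C, hC0, hC⟩ := exists_bound φ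
  obtain ⟨S, hS0, hS⟩ := hv.bounded_approx hs
  obtain ⟨W, hW⟩ := hw.bounded
  have happ : ∀ i j, Tendsto (fun n => tri φ (v n i) (w n j)
      - tri φ (toL2 (s n i)) (toL2 (t n j))) atTop (𝓝 0) := by
    intro i j
    have h1 := (((tendsto_norm_sub_of_le hs i).mul_const W).const_mul C).add
      (((tendsto_norm_sub_of_le ht j).const_mul S).const_mul C)
    simp only [mul_zero, zero_mul, add_zero] at h1
    refine squeeze_zero_norm (fun n => ?_) h1
    have h2 : tri φ (v n i) (w n j) - tri φ (toL2 (s n i)) (toL2 (t n j))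
        = tri φ (v n i - toL2 (s n i)) (w n j) + tri φ (toL2 (s n i)) (w n j - toL2 (t n j)) := by
      rw [tri_sub_left φ.continuous hC, tri_sub_right φ.continuous hC]
      ring
    rw [h2]
    refine (norm_add_le _ _).trans (add_le_add ((abs_tri_le hC _ _).trans ?_)
      ((abs_tri_le hC _ _).trans ?_))
    · gcongr
      exact hW n j
    · gcongr
      exact hS n i
  have := hmain.add ((happ k l).sub (happ l k))
  simp only [sub_zero, add_zero] at this
  refine this.congr fun n => ?_
  simp only [tri_toL2, inner_mulS, hχφ]
  ring

end

/-! ### Compactness in `H⁻¹_loc` and the curl-curl lemma on `Ω`. -/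

section

variable {d : ℕ}

/-! ### Approximate Riesz representation on a pre-Hilbert space -/

/-- A near-minimizer of `‖ι ψ‖² / 2 - S ψ` almost represents `S`. No completeness is needed, and the
representative lies in `V` itself; for test functions it is therefore smooth. -/
lemma exists_approx_riesz {V H : Type*} [AddCommGroup V] [Module ℝ V] [NormedAddCommGroup H]
    [InnerProductSpace ℝ H] (ι : V →ₗ[ℝ] H) (S : V →ₗ[ℝ] ℝ) {C : ℝ}
    (hS : ∀ ψ, |S ψ| ≤ C * ‖ι ψ‖) {ε : ℝ} (hε : 0 < ε) :
    ∃ θ, ∀ ψ, |S ψ - ⟪ι θ, ι ψ⟫| ≤ ε * ‖ι ψ‖ := by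
  set J : V → ℝ := fun ψ => ‖ι ψ‖ ^ 2 / 2 - S ψ with hJ
  have hbdd : BddBelow (Set.range J) := by
    refine ⟨-(C ^ 2 / 2), ?_⟩
    rintro _ ⟨ψ, rfl⟩
    have := (le_abs_self _).trans (hS ψ)
    simp only [hJ]
    nlinarith [sq_nonneg (C - ‖ι ψ‖)]
  -- The slack `ε² / 2` is what turns the discriminant of the quadratic in `t` below into the bound
  -- `ε² ‖ι ψ‖²`.
  obtain ⟨θ, hθ⟩ := exists_lt_of_ciInf_lt
    (show ⨅ ψ, J ψ < (⨅ ψ, J ψ) + ε ^ 2 / 2 by linarith [pow_pos hε 2])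
  refine ⟨θ, fun ψ => ?_⟩
  have hq : ∀ t : ℝ, 0 ≤ ‖ι ψ‖ ^ 2 / 2 * (t * t) + (⟪ι θ, ι ψ⟫ - S ψ) * t + ε ^ 2 / 2 := by
    intro t
    have h1 : ⨅ ψ, J ψ ≤ J (θ + t • ψ) := ciInf_le hbdd _
    have h2 : J (θ + t • ψ) = J θ + ‖ι ψ‖ ^ 2 / 2 * (t * t) + (⟪ι θ, ι ψ⟫ - S ψ) * t := by
      simp only [hJ, map_add, map_smul, smul_eq_mul]
      rw [norm_add_sq_real, inner_smul_right, norm_smul, mul_pow, Real.norm_eq_abs, sq_abs]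
      ring
    linarith
  have hd := discrim_le_zero hq
  rw [discrim] at hd
  rw [abs_sub_comm]
  refine abs_le_of_sq_le_sq ?_ (by positivity)
  linarith [mul_pow ε ‖ι ψ‖ 2]

lemma tendsto_of_inner_tendsto_zero {V H : Type*} [AddCommGroup V] [Module ℝ V]
    [NormedAddCommGroup H] [InnerProductSpace ℝ H] (ι : V →ₗ[ℝ] H) (S : V →ₗ[ℝ] ℝ) {C : ℝ}
    (hS : ∀ ψ, |S ψ| ≤ C * ‖ι ψ‖) {ψ : ℕ → V} {M : ℝ} (hM : ∀ n, ‖ι (ψ n)‖ ≤ M)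
    (h : ∀ θ, Tendsto (fun n => ⟪ι θ, ι (ψ n)⟫) atTop (𝓝 0)) :
    Tendsto (fun n => S (ψ n)) atTop (𝓝 0) := by
  have hM0 : 0 ≤ M := (norm_nonneg _).trans (hM 0)
  rw [Metric.tendsto_atTop']
  intro ε hε
  -- The denominator has `M + 1` because `M` may be zero.
  obtain ⟨θ, hθ⟩ := exists_approx_riesz ι S hS (show 0 < ε / (2 * (M + 1)) by positivity)
  obtain ⟨N, hN⟩ := Metric.tendsto_atTop'.1 (h θ) (ε / 2) (by positivity)
  refine ⟨N, fun n hn => ?_⟩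
  have h1 := hθ (ψ n)
  have h2 := hN n hn
  rw [dist_zero_right, Real.norm_eq_abs] at h2 ⊢
  have h3 : ε / (2 * (M + 1)) * ‖ι (ψ n)‖ ≤ ε / 2 := by
    calc ε / (2 * (M + 1)) * ‖ι (ψ n)‖ ≤ ε / (2 * (M + 1)) * (M + 1) := by
          gcongr
          linarith [hM n]
      _ = ε / 2 := by field_simp
  calc |S (ψ n)| = |(S (ψ n) - ⟪ι θ, ι (ψ n)⟫) + ⟪ι θ, ι (ψ n)⟫| := by rw [sub_add_cancel]
    _ ≤ _ := abs_add_le _ _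
    _ < ε := by linarith

/-! ### Test functions as Schwartz functions -/

section TestFunctions

variable {Ω : Opens (E d)}

/-- A test function on `Ω`, seen as a Schwartz function. -/
def toS : 𝓓(Ω, ℝ) →ₗ[ℝ] 𝓢(E d, ℝ) where
  toFun φ := φ.hasCompactSupport.toSchwartzMap φ.contDiff
  map_add' φ ψ := by ext x; rfl
  map_smul' c φ := by ext x; rfl

lemma coe_toS (φ : 𝓓(Ω, ℝ)) : ⇑(toS φ) = φ := rfl

/-- A Schwartz function with compact support in `Ω`, seen as a test function. -/
def toD (f : 𝓢(E d, ℝ)) (hf : HasCompactSupport f) (hfΩ : tsupport f ⊆ Ω) : 𝓓(Ω, ℝ) :=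
  ⟨f, f.smooth ⊤, hf, hfΩ⟩

lemma toS_toD (f : 𝓢(E d, ℝ)) (hf : HasCompactSupport f) (hfΩ : tsupport f ⊆ Ω) :
    toS (toD f hf hfΩ) = f := by
  ext x; rfl

lemma lineDeriv_testFunction_apply (i : Fin d) (φ : 𝓓(Ω, ℝ)) (x : E d) :
    (∂_{(e i : E d)} φ) x = D i (toS φ) x := by
  rw [TestFunction.lineDerivOp_eq_lineDerivCLM ℝ, TestFunction.lineDerivCLM_apply_of_le (by simp)]
  rw [D_apply, pd, coe_toS, DifferentiableAt.lineDeriv_eq_fderiv]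
  exact (φ.contDiff.differentiable (by simp)).differentiableAt

/-- The space `H = L² × (L²)^d`, in which a test function `φ` is represented by `(φ, ∇φ)`. -/
abbrev JetSpace (d : ℕ) : Type := PiLp 2 (fun _ : Option (Fin d) => L2 d)

/-- The map `φ ↦ (φ, ∇φ)`. -/
def jet : 𝓢(E d, ℝ) →ₗ[ℝ] JetSpace d where
  toFun f := WithLp.toLp 2 fun i => i.elim (toL2 f) fun i => toL2 (D i f)
  map_add' f g := by
    ext1 i
    cases i <;> simp
  map_smul' c f := by
    ext1 i
    cases i <;> simp

lemma inner_jet (f g : 𝓢(E d, ℝ)) :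
    ⟪jet f, jet g⟫ = ⟪toL2 f, toL2 g⟫ + ∑ i, ⟪toL2 (D i f), toL2 (D i g)⟫ := by
  rw [PiLp.inner_apply, Fintype.sum_option]
  rfl

lemma h1Norm_eq (φ : 𝓓(Ω, ℝ)) : h1Norm φ = ‖jet (toS φ)‖ := by
  rw [@norm_eq_sqrt_real_inner, inner_jet, h1Norm]
  simp only [inner_toL2, D_apply, coe_toS, sq]

/-- Both derivatives can be put on the smooth `θ`, and what remains, `⟪θ - Δθ, ψ_n⟫`, needs only
convergence in `L²`. -/
lemma NullTestSeq.tendsto_inner_jet {ψ : ℕ → 𝓢(E d, ℝ)} (hψ : NullTestSeq Ω ψ) (θ : 𝓢(E d, ℝ)) :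
    Tendsto (fun n => ⟪jet θ, jet (ψ n)⟫) atTop (𝓝 0) := by
  have h1 : ∀ n, ⟪jet θ, jet (ψ n)⟫ = ⟪toL2 (θ - ∑ i, D i (D i θ)), toL2 (ψ n)⟫ := by
    intro n
    rw [inner_jet, map_sub, map_sum, inner_sub_left, sum_inner, sub_eq_add_neg,
      ← Finset.sum_neg_distrib]
    simp only [inner_D_right]
  simp only [h1]
  have := hψ.tendsto.const_mul ‖toL2 (θ - ∑ i, D i (D i θ))‖
  rw [mul_zero] at this
  exact squeeze_zero_norm (fun n => norm_inner_le_norm _ _) this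

lemma NullTestSeq.bounded_jet {ψ : ℕ → 𝓢(E d, ℝ)} (hψ : NullTestSeq Ω ψ) :
    ∃ M, ∀ n, ‖jet (ψ n)‖ ≤ M := by
  obtain ⟨M, hM⟩ := hψ.bounded
  obtain ⟨B, hB⟩ := hψ.tendsto.bddAbove_range
  refine ⟨Real.sqrt (B ^ 2 + ∑ _i : Fin d, M ^ 2), fun n => ?_⟩
  rw [@norm_eq_sqrt_real_inner, inner_jet]
  refine Real.sqrt_le_sqrt (add_le_add ?_ (Finset.sum_le_sum fun i _ => ?_))
  · rw [real_inner_self_eq_norm_sq]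
    exact pow_le_pow_left₀ (norm_nonneg _) (hB ⟨n, rfl⟩) 2
  · rw [real_inner_self_eq_norm_sq]
    exact pow_le_pow_left₀ (norm_nonneg _) (hM n i) 2

/-- Test functions supported in a set `K`. -/
def supportedIn (Ω : Opens (E d)) (K : Set (E d)) : Submodule ℝ 𝓓(Ω, ℝ) where
  carrier := {φ | ∀ x ∉ K, φ x = 0}
  add_mem' {φ ψ} hφ hψ x hx := by
    change φ x + ψ x = 0
    rw [hφ x hx, hψ x hx, add_zero]
  zero_mem' x hx := rfl
  smul_mem' c φ hφ x hx := by
    change c • φ x = 0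
    rw [hφ x hx, smul_zero]

lemma tsupport_subset_of_mem_supportedIn {K : Set (E d)} (hK : IsCompact K) {φ : 𝓓(Ω, ℝ)}
    (hφ : φ ∈ supportedIn Ω K) : tsupport φ ⊆ K :=
  closure_minimal (fun x hx => by by_contra h; exact hx (hφ x h)) hK.isClosed

/-- An element of `H⁻¹_loc` is sequentially continuous along null sequences of test functions. -/
lemma HMinusOneLoc.tendsto (S : HMinusOneLoc Ω) {φ : ℕ → 𝓓(Ω, ℝ)}
    (hφ : NullTestSeq Ω (fun n => toS (φ n))) :
    Tendsto (fun n => S.toDistribution (φ n)) atTop (𝓝 0) := by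
  obtain ⟨K, hK, hKΩ, hsupp⟩ := hφ.support
  obtain ⟨C, hC⟩ := S.bounded K hK hKΩ
  obtain ⟨M, hM⟩ := hφ.bounded_jet
  have hmem : ∀ n, φ n ∈ supportedIn Ω K := fun n x hx =>
    image_eq_zero_of_notMem_tsupport (f := φ n) fun h => hx (hsupp n h)
  -- The Riesz argument runs on the functions supported in `K`, since the `H¹` bound on `S` has a
  -- constant depending on `K`.
  refine tendsto_of_inner_tendsto_zero (V := supportedIn Ω K)
    (jet ∘ₗ toS ∘ₗ (supportedIn Ω K).subtype)
    ((S.toDistribution : 𝓓(Ω, ℝ) →ₗ[ℝ] ℝ) ∘ₗ (supportedIn Ω K).subtype) (C := C)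
    (fun ψ => ?_) (ψ := fun n => ⟨φ n, hmem n⟩) hM (fun θ => hφ.tendsto_inner_jet _)
  have := hC ψ.1 (tsupport_subset_of_mem_supportedIn hK ψ.2)
  rwa [h1Norm_eq] at this

/-- Distributions confined in a compact subset of `H⁻¹_loc` converge to zero uniformly along
null sequences of test functions. -/
lemma ConfinedInCompactHMinusOneLoc.tendsto {T : ℕ → 𝓓'(Ω, ℝ)}
    (hT : ConfinedInCompactHMinusOneLoc T) {φ : ℕ → 𝓓(Ω, ℝ)}
    (hφ : NullTestSeq Ω (fun n => toS (φ n))) :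
    Tendsto (fun n => T n (φ n)) atTop (𝓝 0) := by
  obtain ⟨𝒦, h𝒦, hmem⟩ := hT
  choose S hS hST using hmem
  obtain ⟨K, hK, hKΩ, hsupp⟩ := hφ.support
  obtain ⟨M, hM⟩ := hφ.bounded_jet
  -- The whole sequence is one of the sets defining the topology, so closeness in `H⁻¹_loc` is
  -- uniform along it.
  have hB : Set.range φ ∈ h1BoundedSets Ω := by
    refine ⟨K, M, hK, hKΩ, ?_⟩
    rintro _ ⟨n, rfl⟩
    exact ⟨hsupp n, by rw [h1Norm_eq]; exact hM n⟩
  rw [Metric.tendsto_nhds]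
  intro ε hε
  have hnhds : ∀ S₀ : HMinusOneLoc Ω, {S | ∀ n,
      |S.toDistribution (φ n) - S₀.toDistribution (φ n)| < ε / 2} ∈ 𝓝 S₀ := by
    intro S₀
    have hc : Continuous (fun T : HMinusOneLoc Ω => UniformOnFun.ofFun (h1BoundedSets Ω)
      (fun φ : 𝓓(Ω, ℝ) => T.toDistribution φ)) := continuous_induced_dom
    have h1 := UniformOnFun.tendsto_iff_tendstoUniformlyOn.1 (hc.tendsto S₀) _ hB
    rw [Metric.tendstoUniformlyOn_iff] at h1
    filter_upwards [h1 (ε / 2) (half_pos hε)] with S hS n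
    have := hS (φ n) ⟨n, rfl⟩
    rwa [dist_comm, Real.dist_eq] at this
  -- Finitely many centres approximate all `T n`, which reduces the claim to finitely many fixed
  -- functionals.
  obtain ⟨t, -, ht⟩ := h𝒦.elim_nhds_subcover _ (fun S₀ _ => hnhds S₀)
  have hall : ∀ᶠ n in atTop, ∀ S₀ ∈ t, |S₀.toDistribution (φ n)| < ε / 2 := by
    rw [Filter.eventually_all_finset]
    intro S₀ _
    have := Metric.tendsto_nhds.1 (S₀.tendsto hφ) (ε / 2) (half_pos hε)
    simpa using this
  filter_upwards [hall] with n hn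
  obtain ⟨S₀, hS₀, h1⟩ := Set.mem_iUnion₂.1 (ht (hS n))
  have h2 := hn S₀ hS₀
  have h3 : |(S n).toDistribution (φ n) - S₀.toDistribution (φ n)| < ε / 2 := h1 n
  rw [dist_zero_right, Real.norm_eq_abs, ← hST n]
  calc |(S n).toDistribution (φ n)| = |((S n).toDistribution (φ n) - S₀.toDistribution (φ n))
        + S₀.toDistribution (φ n)| := by rw [sub_add_cancel]
    _ ≤ _ := abs_add_le _ _
    _ < ε := by linarith

/-! ### Functions in `L²(Ω)` -/

lemma toDistr_apply {u : E d → ℝ} (hu : LocallyIntegrableOn u Ω) (φ : 𝓓(Ω, ℝ)) :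
    toDistr Ω u φ = ∫ x, φ x * u x :=
  TestFunction.integralAgainstBilinCLM_eq_integral hu

lemma locallyIntegrableOn_of_memLp {u : E d → ℝ} {p : ℝ≥0∞} (hp : 1 ≤ p)
    (hu : MemLp u p (volume.restrict (Ω : Set (E d)))) : LocallyIntegrableOn u Ω :=
  locallyIntegrableOn_of_locallyIntegrable_restrict (hu.locallyIntegrable hp)

open scoped Classical in
/-- The extension by zero of `u ∈ L²(Ω)` as an element of `L²(ℝ^d)`. -/
def extend (Ω : Opens (E d)) (u : E d → ℝ) : L2 d :=
  if h : MemLp ((Ω : Set (E d)).indicator u) 2 volume then h.toLp _ else 0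

lemma coeFn_extend {u : E d → ℝ} (hu : MemLp u 2 (volume.restrict (Ω : Set (E d)))) :
    extend Ω u =ᵐ[volume] (Ω : Set (E d)).indicator u := by
  have h : MemLp ((Ω : Set (E d)).indicator u) 2 volume :=
    (memLp_indicator_iff_restrict Ω.isOpen.measurableSet).2 hu
  rw [extend, dif_pos h]
  exact h.coeFn_toLp

lemma inner_extend_left {u : E d → ℝ} (hu : MemLp u 2 (volume.restrict (Ω : Set (E d))))
    (f : L2 d) : ⟪extend Ω u, f⟫ = ∫ x in (Ω : Set (E d)), u x * f x := by
  rw [L2.inner_def, ← integral_indicator Ω.isOpen.measurableSet]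
  refine integral_congr_ae ?_
  filter_upwards [coeFn_extend hu] with x hx
  rw [hx]
  by_cases hxΩ : x ∈ (Ω : Set (E d)) <;> simp [hxΩ, mul_comm]

lemma norm_extend {u : E d → ℝ} (hu : MemLp u 2 (volume.restrict (Ω : Set (E d)))) :
    ‖extend Ω u‖ = (eLpNorm u 2 (volume.restrict (Ω : Set (E d)))).toReal := by
  rw [Lp.norm_def, eLpNorm_congr_ae (coeFn_extend hu),
    eLpNorm_indicator_eq_eLpNorm_restrict Ω.isOpen.measurableSet]

lemma tri_extend {u w : E d → ℝ} (hu : MemLp u 2 (volume.restrict (Ω : Set (E d))))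
    (hw : MemLp w 2 (volume.restrict (Ω : Set (E d)))) {φ : E d → ℝ} (hφ : tsupport φ ⊆ Ω) :
    tri φ (extend Ω u) (extend Ω w) = ∫ x, φ x * (u x * w x) := by
  refine integral_congr_ae ?_
  filter_upwards [coeFn_extend hu, coeFn_extend hw] with x h1 h2
  rw [h1, h2]
  by_cases hxΩ : x ∈ (Ω : Set (E d))
  · simp [hxΩ]
  · rw [image_eq_zero_of_notMem_tsupport fun h => hxΩ (hφ h)]
    simp

lemma inner_extend_toL2 {u : E d → ℝ} (hu : MemLp u 2 (volume.restrict (Ω : Set (E d))))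
    {f : 𝓢(E d, ℝ)} (hf : tsupport f ⊆ Ω) :
    ⟪extend Ω u, toL2 f⟫ = ∫ x, f x * u x := by
  rw [inner_toL2_right]
  refine integral_congr_ae ?_
  filter_upwards [coeFn_extend hu] with x h1
  rw [h1]
  by_cases hxΩ : x ∈ (Ω : Set (E d))
  · simp [hxΩ, mul_comm]
  · rw [image_eq_zero_of_notMem_tsupport fun h => hxΩ (hf h)]
    simp

lemma tsupport_D_subset (i : Fin d) (f : 𝓢(E d, ℝ)) : tsupport (D i f) ⊆ tsupport f :=
  SchwartzMap.tsupport_lineDerivOp_subset (e i) f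

lemma lineDeriv_toDistr_apply {u : E d → ℝ}
    (hu : MemLp u 2 (volume.restrict (Ω : Set (E d)))) (i : Fin d) (φ : 𝓓(Ω, ℝ)) :
    (∂_{(e i : E d)} (toDistr Ω u)) φ = -⟪extend Ω u, toL2 (D i (toS φ))⟫ := by
  rw [Distribution.lineDerivOp_apply_apply, map_neg,
    toDistr_apply (locallyIntegrableOn_of_memLp (by norm_num) hu),
    inner_extend_toL2 hu ((tsupport_D_subset i _).trans φ.tsupport_subset)]
  simp only [lineDeriv_testFunction_apply]

lemma curl_apply {w : Fin d → E d → ℝ}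
    (hw : ∀ k, MemLp (w k) 2 (volume.restrict (Ω : Set (E d)))) (k l : Fin d) (φ : 𝓓(Ω, ℝ)) :
    curl Ω w k l φ = -(⟪extend Ω (w l), toL2 (D k (toS φ))⟫
      - ⟪extend Ω (w k), toL2 (D l (toS φ))⟫) := by
  change (∂_{(e k : E d)} (toDistr Ω (w l))) φ - (∂_{(e l : E d)} (toDistr Ω (w k))) φ = _
  rw [lineDeriv_toDistr_apply (hw l), lineDeriv_toDistr_apply (hw k)]
  ring

lemma curlNullOn_of_confined {w : ℕ → Fin d → E d → ℝ}
    (hw : ∀ n k, MemLp (w n k) 2 (volume.restrict (Ω : Set (E d))))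
    (hc : ∀ k l, ConfinedInCompactHMinusOneLoc (fun n => curl Ω (w n) k l)) :
    CurlNullOn Ω (fun n k => extend Ω (w n k)) := by
  intro ψ hψ k l
  obtain ⟨K, hK, hKΩ, hsupp⟩ := hψ.support
  have hcs : ∀ n, HasCompactSupport (ψ n) := fun n =>
    hK.of_isClosed_subset (isClosed_tsupport _) (hsupp n)
  have := ((hc k l).tendsto (φ := fun n => toD (ψ n) (hcs n) ((hsupp n).trans hKΩ))
    (by simpa only [toS_toD] using hψ)).neg
  rw [neg_zero] at this
  refine this.congr fun n => ?_
  rw [curl_apply (hw n), toS_toD, neg_neg]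

end TestFunctions

/-! ### The curl-curl lemma -/

section CurlCurl

variable {Ω : Opens (E d)}

/-- For Schwartz `f` the derivative is moved onto `f`; density and the gradient bound give the rest.
Consequently the curl of a fixed `L²` field is negligible, and weak limits can be subtracted. -/
lemma NullTestSeq.tendsto_inner_D {ψ : ℕ → 𝓢(E d, ℝ)} (hψ : NullTestSeq Ω ψ) (f : L2 d)
    (k : Fin d) : Tendsto (fun n => ⟪f, toL2 (D k (ψ n))⟫) atTop (𝓝 0) := by
  obtain ⟨M, hM⟩ := hψ.bounded
  have hM0 : 0 ≤ M := (norm_nonneg _).trans (hM 0 k)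
  rw [Metric.tendsto_nhds]
  intro ε hε
  obtain ⟨g, hg⟩ := exists_schwartz_norm_sub_le f (show 0 < ε / (2 * (M + 1)) by positivity)
  have h1 : Tendsto (fun n => ⟪toL2 g, toL2 (D k (ψ n))⟫) atTop (𝓝 0) := by
    have := hψ.tendsto.const_mul ‖toL2 (D k g)‖
    rw [mul_zero] at this
    refine squeeze_zero_norm (fun n => ?_) this
    rw [inner_D_right, norm_neg]
    exact norm_inner_le_norm _ _
  filter_upwards [Metric.tendsto_nhds.1 h1 (ε / 2) (half_pos hε)] with n hn
  rw [dist_zero_right, Real.norm_eq_abs] at hn ⊢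
  have h2 : |⟪f - toL2 g, toL2 (D k (ψ n))⟫| ≤ ε / 2 := by
    calc _ ≤ ‖f - toL2 g‖ * ‖toL2 (D k (ψ n))‖ := abs_real_inner_le_norm _ _
      _ ≤ ε / (2 * (M + 1)) * (M + 1) := by
          gcongr
          linarith [hM n k]
      _ = ε / 2 := by field_simp
  calc |⟪f, toL2 (D k (ψ n))⟫|
      = |⟪f - toL2 g, toL2 (D k (ψ n))⟫ + ⟪toL2 g, toL2 (D k (ψ n))⟫| := by
        rw [inner_sub_left, sub_add_cancel]
    _ ≤ _ := abs_add_le _ _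
    _ < ε := by linarith

/-- Bounded sequences of fields in `L²` that converge weakly to `v₀` and whose curls on `Ω` are
compact in `H⁻¹_loc`, in the form in which the curl-curl lemma uses compactness. -/
structure WeakCurlLimit (Ω : Opens (E d)) (v : ℕ → Fin d → L2 d) (v₀ : Fin d → L2 d) : Prop where
  bounded : ∃ M, ∀ n k, ‖v n k‖ ≤ M
  tendsto : ∀ k (f : L2 d), Tendsto (fun n => ⟪v n k, f⟫) atTop (𝓝 ⟪v₀ k, f⟫)
  curl : CurlNullOn Ω v

lemma WeakCurlLimit.weaklyNull {v : ℕ → Fin d → L2 d} {v₀ : Fin d → L2 d}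
    (hv : WeakCurlLimit Ω v v₀) : WeaklyNull Ω (fun n k => v n k - v₀ k) := by
  obtain ⟨M, hM⟩ := hv.bounded
  refine ⟨⟨M + ∑ k, ‖v₀ k‖, fun n k => ?_⟩, fun k f => ?_, fun ψ hψ k l => ?_⟩
  · exact (norm_sub_le _ _).trans (add_le_add (hM n k)
      (Finset.single_le_sum (f := fun k => ‖v₀ k‖) (fun _ _ => norm_nonneg _)
        (Finset.mem_univ k)))
  · have := (hv.tendsto k f).sub_const ⟪v₀ k, f⟫
    simpa only [inner_sub_left, sub_self] using this
  · have := (hv.curl ψ hψ k l).sub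
      ((hψ.tendsto_inner_D (v₀ l) k).sub (hψ.tendsto_inner_D (v₀ k) l))
    simp only [sub_zero] at this
    refine this.congr fun n => ?_
    simp only [inner_sub_left]
    ring

lemma exists_tri_eq_inner {φ : E d → ℝ} (hφ : Continuous φ) {C : ℝ} (hC : ∀ x, |φ x| ≤ C)
    (w : L2 d) : ∃ g : L2 d, ∀ v, tri φ v w = ⟪v, g⟫ := by
  have hm : MemLp (fun x => φ x * w x) 2 volume := by
    refine (Lp.memLp w).of_le_mul (c := C)
      (hφ.aestronglyMeasurable.mul (Lp.aestronglyMeasurable w)) (.of_forall fun x => ?_)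
    rw [norm_mul]
    gcongr
    exact hC x
  refine ⟨hm.toLp _, fun v => ?_⟩
  rw [L2.inner_def]
  refine integral_congr_ae ?_
  filter_upwards [hm.coeFn_toLp] with x hx
  rw [hx]
  simp
  ring

/-- Write `v w = (v - v₀)(w - w₀) + v w₀ + v₀ w - v₀ w₀`. Only the first product is quadratic in the
oscillation; the others converge by weak convergence alone. -/
lemma WeakCurlLimit.tendsto_tri_schwartz {v w : ℕ → Fin d → L2 d} {v₀ w₀ : Fin d → L2 d}
    (hv : WeakCurlLimit Ω v v₀) (hw : WeakCurlLimit Ω w w₀) {φ : 𝓢(E d, ℝ)}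
    (hφ : HasCompactSupport φ) (hφΩ : tsupport φ ⊆ Ω) (k l : Fin d) :
    Tendsto (fun n => tri φ (v n k) (w n l) - tri φ (v n l) (w n k)) atTop
      (𝓝 (tri φ (v₀ k) (w₀ l) - tri φ (v₀ l) (w₀ k))) := by
  obtain ⟨C, -, hC⟩ := exists_bound φ
  have h0 := hv.weaklyNull.tendsto_tri hw.weaklyNull hφ hφΩ k l
  have h1 : ∀ i j, Tendsto (fun n => tri φ (v n i) (w₀ j)) atTop (𝓝 (tri φ (v₀ i) (w₀ j))) := by
    intro i j
    obtain ⟨g, hg⟩ := exists_tri_eq_inner φ.continuous hC (w₀ j)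
    simpa only [hg] using hv.tendsto i g
  have h2 : ∀ i j, Tendsto (fun n => tri φ (v₀ i) (w n j)) atTop (𝓝 (tri φ (v₀ i) (w₀ j))) := by
    intro i j
    obtain ⟨g, hg⟩ := exists_tri_eq_inner φ.continuous hC (v₀ i)
    simpa only [tri_comm φ (v₀ i), hg] using hw.tendsto j g
  have h3 := ((h0.add (((h1 k l).add (h2 k l)).sub_const (tri φ (v₀ k) (w₀ l)))).sub
    (((h1 l k).add (h2 l k)).sub_const (tri φ (v₀ l) (w₀ k))))
  simp only [zero_add, add_sub_cancel_right] at h3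
  refine h3.congr fun n => ?_
  simp only [tri_sub_left φ.continuous hC, tri_sub_right φ.continuous hC]
  ring

lemma tri_sub_weight {φ ψ : E d → ℝ} (hφ : Continuous φ) (hψ : Continuous ψ) {A B : ℝ}
    (hA : ∀ x, |φ x| ≤ A) (hB : ∀ x, |ψ x| ≤ B) (v w : L2 d) :
    tri (fun x => φ x - ψ x) v w = tri φ v w - tri ψ v w := by
  rw [tri, tri, tri, ← integral_sub (integrable_tri hφ hA _ _) (integrable_tri hψ hB _ _)]
  simp only [sub_mul]

/-- **Curl-curl lemma.** The antisymmetrized products of two weakly convergent sequences of fields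
with curls compact in `H⁻¹_loc` converge to the products of the limits when tested against
continuous functions with compact support. -/
theorem WeakCurlLimit.tendsto_tri {v w : ℕ → Fin d → L2 d} {v₀ w₀ : Fin d → L2 d}
    (hv : WeakCurlLimit Ω v v₀) (hw : WeakCurlLimit Ω w w₀) {φ : E d → ℝ} (hφc : Continuous φ)
    (hφ : HasCompactSupport φ) (hφΩ : tsupport φ ⊆ Ω) (k l : Fin d) :
    Tendsto (fun n => tri φ (v n k) (w n l) - tri φ (v n l) (w n k)) atTop
      (𝓝 (tri φ (v₀ k) (w₀ l) - tri φ (v₀ l) (w₀ k))) := by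
  obtain ⟨A, hA⟩ := hv.bounded
  obtain ⟨B, hB⟩ := hw.bounded
  obtain ⟨C, hC⟩ := hφ.exists_bound_of_continuous hφc
  set Q : ℝ := 2 * (|A| * |B|) + |‖v₀ k‖ * ‖w₀ l‖ + ‖v₀ l‖ * ‖w₀ k‖| with hQ
  have hQ0 : 0 ≤ Q := by positivity
  rw [Metric.tendsto_nhds]
  intro ε hε
  set δ : ℝ := ε / (2 * (Q + 1)) with hδ
  have hδ0 : 0 < δ := by positivity
  -- A smooth `g` uniformly `δ`-close to `φ`, with support inside that of `φ`. The number `Q`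
  -- dominates the four products being compared, so replacing `φ` costs at most `ε / 2`.
  obtain ⟨g, hg, hgφ, hgs⟩ := hφc.exists_contDiff_approx (E := E d) (F := ℝ) ⊤
    (continuous_const (y := δ)) (fun _ => hδ0)
  have hgts : tsupport g ⊆ tsupport φ := closure_mono hgs
  have hgc : HasCompactSupport g := hφ.of_isClosed_subset (isClosed_tsupport _) hgts
  obtain ⟨C', hC'⟩ := hgc.exists_bound_of_continuous hg.continuous
  have hlim := hv.tendsto_tri_schwartz hw (φ := hgc.toSchwartzMap hg) hgc (hgts.trans hφΩ) k l
  have hdiff : ∀ a b, |tri φ a b - tri g a b| ≤ δ * (‖a‖ * ‖b‖) := by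
    intro a b
    rw [← tri_sub_weight hφc hg.continuous hC hC']
    refine abs_tri_le (fun x => ?_) a b
    have := (hgφ x).le
    rwa [dist_comm, Real.dist_eq] at this
  filter_upwards [Metric.tendsto_nhds.1 hlim (ε / 2) (half_pos hε)] with n hn
  rw [Real.dist_eq] at hn ⊢
  change |tri g (v n k) (w n l) - tri g (v n l) (w n k)
    - (tri g (v₀ k) (w₀ l) - tri g (v₀ l) (w₀ k))| < ε / 2 at hn
  have hvw : ∀ i j, ‖v n i‖ * ‖w n j‖ ≤ |A| * |B| := fun i j =>
    mul_le_mul ((hA n i).trans (le_abs_self A)) ((hB n j).trans (le_abs_self B))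
      (norm_nonneg _) (abs_nonneg _)
  have h1 := (hdiff (v n k) (w n l)).trans (mul_le_mul_of_nonneg_left (hvw k l) hδ0.le)
  have h2 := (hdiff (v n l) (w n k)).trans (mul_le_mul_of_nonneg_left (hvw l k) hδ0.le)
  have h3 := hdiff (v₀ k) (w₀ l)
  have h4 := hdiff (v₀ l) (w₀ k)
  have h5 : δ * (|A| * |B|) + δ * (|A| * |B|) + δ * (‖v₀ k‖ * ‖w₀ l‖) + δ * (‖v₀ l‖ * ‖w₀ k‖)
      ≤ ε / 2 := by
    calc _ = δ * (2 * (|A| * |B|) + (‖v₀ k‖ * ‖w₀ l‖ + ‖v₀ l‖ * ‖w₀ k‖)) := by ring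
      _ ≤ δ * (Q + 1) := by
          refine mul_le_mul_of_nonneg_left ?_ hδ0.le
          rw [hQ]
          linarith [le_abs_self (‖v₀ k‖ * ‖w₀ l‖ + ‖v₀ l‖ * ‖w₀ k‖)]
      _ = ε / 2 := by rw [hδ]; field_simp
  rw [abs_le] at h1 h2 h3 h4
  rw [abs_lt] at hn ⊢
  constructor <;> linarith [h1.1, h1.2, h2.1, h2.2, h3.1, h3.2, h4.1, h4.2, hn.1, hn.2]

end CurlCurl

end

/-! ### Weak limits of fields and convergence against continuous test functions. -/

section

/-! ### Weak sequential compactness -/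

/-- Bounded sequences in a separable Hilbert space have weakly convergent subsequences. -/
lemma exists_weak_limit {H : Type*} [NormedAddCommGroup H] [InnerProductSpace ℝ H]
    [CompleteSpace H] [SeparableSpace H] {x : ℕ → H} {C : ℝ} (hx : ∀ n, ‖x n‖ ≤ C) :
    ∃ (s : ℕ → ℕ) (y : H), StrictMono s ∧
      ∀ f, Tendsto (fun n => ⟪x (s n), f⟫) atTop (𝓝 ⟪y, f⟫) := by
  have hmem : ∀ n, StrongDual.toWeakDual (InnerProductSpace.toDual ℝ H (x n)) ∈
      WeakDual.toStrongDual ⁻¹' Metric.closedBall (0 : StrongDual ℝ H) C := by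
    intro n
    change InnerProductSpace.toDual ℝ H (x n) ∈ Metric.closedBall 0 C
    simpa using hx n
  obtain ⟨φ, -, s, hs, hφ⟩ := WeakDual.isSeqCompact_closedBall ℝ H 0 C hmem
  refine ⟨s, (InnerProductSpace.toDual ℝ H).symm (WeakDual.toStrongDual φ), hs, fun f => ?_⟩
  have h := ((WeakDual.eval_continuous f).tendsto φ).comp hφ
  rw [InnerProductSpace.toDual_symm_apply]
  exact h

/-- Testing the sequence against its own limit is enough for lower semicontinuity of the norm. -/
lemma norm_le_of_weak_limit {H : Type*} [NormedAddCommGroup H] [InnerProductSpace ℝ H]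
    {x : ℕ → H} {y : H} {C : ℝ} (hx : ∀ n, ‖x n‖ ≤ C)
    (h : Tendsto (fun n => ⟪x n, y⟫) atTop (𝓝 ⟪y, y⟫)) : ‖y‖ ≤ C := by
  have h1 : ⟪y, y⟫ ≤ C * ‖y‖ := le_of_tendsto' h fun n =>
    (real_inner_le_norm _ _).trans (by gcongr; exact hx n)
  rw [real_inner_self_eq_norm_sq, sq] at h1
  rcases (norm_nonneg y).eq_or_lt with h0 | h0
  · rw [← h0]
    exact (norm_nonneg _).trans (hx 0)
  · exact le_of_mul_le_mul_right h1 h0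

variable {d N : ℕ} {Ω : Opens (E d)}

instance : SecondCountableTopology (L2 d) :=
  haveI : Fact ((2 : ℝ≥0∞) ≠ ⊤) := ⟨by simp⟩
  inferInstance

/-! ### Extension by zero -/

lemma memLp_coe_restrict (x : L2 d) : MemLp x 2 (volume.restrict (Ω : Set (E d))) :=
  (Lp.memLp x).restrict _

lemma inner_extend_right (x : L2 d) {f : E d → ℝ}
    (hf : MemLp f 2 (volume.restrict (Ω : Set (E d)))) :
    ⟪x, extend Ω f⟫ = ∫ y in (Ω : Set (E d)), x y * f y := by
  rw [real_inner_comm, inner_extend_left hf]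
  simp only [mul_comm]

/-- The sequence vanishes outside `Ω`, so cutting the limit `x` down to `Ω` changes no pairing in
the limit. -/
lemma tendsto_inner_extend {u : ℕ → E d → ℝ}
    (hu : ∀ n, MemLp (u n) 2 (volume.restrict (Ω : Set (E d)))) {x : L2 d}
    (h : ∀ f, Tendsto (fun n => ⟪extend Ω (u n), f⟫) atTop (𝓝 ⟪x, f⟫)) (f : L2 d) :
    Tendsto (fun n => ⟪extend Ω (u n), f⟫) atTop (𝓝 ⟪extend Ω x, f⟫) := by
  have h1 := h (extend Ω f)
  rw [inner_extend_right x (memLp_coe_restrict f),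
    ← inner_extend_left (memLp_coe_restrict x)] at h1
  refine h1.congr fun n => ?_
  rw [inner_extend_left (hu n), inner_extend_left (hu n), ← integral_indicator Ω.isOpen.measurableSet,
    ← integral_indicator Ω.isOpen.measurableSet]
  refine integral_congr_ae ?_
  filter_upwards [coeFn_extend (memLp_coe_restrict (Ω := Ω) f)] with y hy
  by_cases hyΩ : y ∈ (Ω : Set (E d))
  · simp [hyΩ, hy]
  · simp [hyΩ]

lemma tendstoWeakL2_of_extend {u : ℕ → E d → ℝ} {v : E d → ℝ}
    (hu : ∀ n, MemLp (u n) 2 (volume.restrict (Ω : Set (E d))))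
    (hv : MemLp v 2 (volume.restrict (Ω : Set (E d))))
    (h : ∀ f, Tendsto (fun n => ⟪extend Ω (u n), f⟫) atTop (𝓝 ⟪extend Ω v, f⟫)) :
    TendstoWeakL2 Ω u v := by
  intro f hf
  have key : ∀ {w : E d → ℝ}, MemLp w 2 (volume.restrict (Ω : Set (E d))) →
      ⟪extend Ω w, extend Ω f⟫ = ∫ x in (Ω : Set (E d)), w x * f x := by
    intro w hw
    rw [inner_extend_left hw, ← integral_indicator Ω.isOpen.measurableSet,
      ← integral_indicator Ω.isOpen.measurableSet]
    refine integral_congr_ae ?_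
    filter_upwards [coeFn_extend hf] with y hy
    by_cases hyΩ : y ∈ (Ω : Set (E d)) <;> simp [hyΩ, hy]
  have := h (extend Ω f)
  simp only [key hv, key (hu _)] at this
  exact this

lemma extend_eq_smul_iff {u w : E d → ℝ} (hu : MemLp u 2 (volume.restrict (Ω : Set (E d))))
    (hw : MemLp w 2 (volume.restrict (Ω : Set (E d)))) (c : ℝ) :
    extend Ω u = c • extend Ω w ↔ ∀ᵐ x ∂(volume.restrict (Ω : Set (E d))), u x = c * w x := by
  rw [ae_restrict_iff' Ω.isOpen.measurableSet, Lp.ext_iff]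
  constructor <;> intro h
  · filter_upwards [h, coeFn_extend hu, coeFn_extend hw, Lp.coeFn_smul c (extend Ω w)]
      with x h1 h2 h3 h4 hx
    rw [h2, h4, Pi.smul_apply, h3] at h1
    simpa [hx] using h1
  · filter_upwards [h, coeFn_extend hu, coeFn_extend hw, Lp.coeFn_smul c (extend Ω w)]
      with x h1 h2 h3 h4
    rw [h2, h4, Pi.smul_apply, h3]
    by_cases hx : x ∈ (Ω : Set (E d))
    · simpa [hx] using h1 hx
    · simp [hx]

/-- Pointwise linear relations pass to weak limits. -/
lemma ae_eq_mul_of_weak_limit {u w : ℕ → E d → ℝ} {u₀ w₀ : E d → ℝ}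
    (hu : ∀ n, MemLp (u n) 2 (volume.restrict (Ω : Set (E d))))
    (hw : ∀ n, MemLp (w n) 2 (volume.restrict (Ω : Set (E d))))
    (hu₀ : MemLp u₀ 2 (volume.restrict (Ω : Set (E d))))
    (hw₀ : MemLp w₀ 2 (volume.restrict (Ω : Set (E d))))
    (hul : ∀ f, Tendsto (fun n => ⟪extend Ω (u n), f⟫) atTop (𝓝 ⟪extend Ω u₀, f⟫))
    (hwl : ∀ f, Tendsto (fun n => ⟪extend Ω (w n), f⟫) atTop (𝓝 ⟪extend Ω w₀, f⟫)) (c : ℝ)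
    (h : ∀ n, ∀ᵐ x ∂(volume.restrict (Ω : Set (E d))), u n x = c * w n x) :
    ∀ᵐ x ∂(volume.restrict (Ω : Set (E d))), u₀ x = c * w₀ x := by
  rw [← extend_eq_smul_iff hu₀ hw₀]
  refine ext_inner_right ℝ fun f => ?_
  rw [inner_smul_left]
  refine tendsto_nhds_unique (hul f) (((hwl f).const_mul c).congr fun n => ?_)
  rw [(extend_eq_smul_iff (hu n) (hw n) c).2 (h n), inner_smul_left]
  rfl

/-! ### Convergence against continuous test functions -/

/-- Convergence of locally integrable functions on `Ω` when tested against continuous functions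
with compact support. -/
structure VagueTendsto (Ω : Opens (E d)) (q : ℕ → E d → ℝ) (q₀ : E d → ℝ) : Prop where
  locInt : ∀ n, LocallyIntegrableOn (q n) Ω
  locInt_limit : LocallyIntegrableOn q₀ Ω
  tendsto : ∀ ψ : E d → ℝ, Continuous ψ → HasCompactSupport ψ → tsupport ψ ⊆ Ω →
    Tendsto (fun n => ∫ x, ψ x * q n x) atTop (𝓝 (∫ x, ψ x * q₀ x))

lemma integrable_mul_of_hasCompactSupport {q ψ : E d → ℝ} (hq : LocallyIntegrableOn q Ω)
    (hψ : Continuous ψ) (hc : HasCompactSupport ψ) (hψΩ : tsupport ψ ⊆ Ω) :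
    Integrable (fun x => ψ x * q x) := by
  have h1 : IntegrableOn (fun x => ψ x * q x) (tsupport ψ) :=
    IntegrableOn.continuousOn_mul hψ.continuousOn (hq.integrableOn_compact_subset hψΩ hc) hc
  rwa [integrableOn_iff_integrable_of_support_subset] at h1
  exact (Function.support_mul_subset_left ψ q).trans (subset_tsupport ψ)

lemma locallyIntegrableOn_sum {ι : Type*} [Fintype ι] {f : ι → E d → ℝ}
    (hf : ∀ i, LocallyIntegrableOn (f i) Ω) : LocallyIntegrableOn (fun x => ∑ i, f i x) Ω := by
  classical
  have : ∀ s : Finset ι, LocallyIntegrableOn (fun x => ∑ i ∈ s, f i x) Ω := by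
    intro s
    induction s using Finset.induction_on with
    | empty => simpa using locallyIntegrableOn_zero
    | insert i s hi ih =>
      simp only [Finset.sum_insert hi]
      exact (hf i).add ih
  exact this _

/-- Coefficients are absorbed into the test function. Since `ψ c_i` is only continuous,
`VagueTendsto` is stated for continuous rather than smooth tests. -/
lemma VagueTendsto.sum_mul {ι : Type*} [Fintype ι] {q : ι → ℕ → E d → ℝ} {q₀ : ι → E d → ℝ}
    (hq : ∀ i, VagueTendsto Ω (q i) (q₀ i)) {c : ι → E d → ℝ} (hc : ∀ i, ContinuousOn (c i) Ω) :
    VagueTendsto Ω (fun n x => ∑ i, c i x * q i n x) (fun x => ∑ i, c i x * q₀ i x) := by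
  refine ⟨fun n => locallyIntegrableOn_sum fun i =>
      ((hq i).locInt n).continuousOn_mul (hc i) Ω.isOpen.isLocallyClosed,
    locallyIntegrableOn_sum fun i =>
      (hq i).locInt_limit.continuousOn_mul (hc i) Ω.isOpen.isLocallyClosed,
    fun ψ hψ hψc hψΩ => ?_⟩
  have hsub : ∀ i, tsupport (fun x => ψ x * c i x) ⊆ tsupport ψ := fun i =>
    tsupport_mul_subset_left
  have hcont : ∀ i, Continuous (fun x => ψ x * c i x) := fun i =>
    (hψ.continuousOn.mul (hc i)).continuous_of_tsupport_subset Ω.isOpen ((hsub i).trans hψΩ)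
  have hcs : ∀ i, HasCompactSupport (fun x => ψ x * c i x) := fun i => hψc.mul_right
  have key : ∀ r : ι → E d → ℝ, (∀ i, LocallyIntegrableOn (r i) Ω) →
      ∫ x, ψ x * ∑ i, c i x * r i x = ∑ i, ∫ x, (ψ x * c i x) * r i x := by
    intro r hr
    rw [← integral_finsetSum _ fun i _ => integrable_mul_of_hasCompactSupport (hr i) (hcont i)
      (hcs i) ((hsub i).trans hψΩ)]
    refine integral_congr_ae (.of_forall fun x => ?_)
    simp only [Finset.mul_sum, mul_assoc]
  simp only [key (fun i => q i _) fun i => (hq i).locInt _,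
    key q₀ fun i => (hq i).locInt_limit]
  exact tendsto_finsetSum _ fun i _ =>
    (hq i).tendsto _ (hcont i) (hcs i) ((hsub i).trans hψΩ)

lemma VagueTendsto.sum {ι : Type*} [Fintype ι] {q : ι → ℕ → E d → ℝ} {q₀ : ι → E d → ℝ}
    (hq : ∀ i, VagueTendsto Ω (q i) (q₀ i)) :
    VagueTendsto Ω (fun n x => ∑ i, q i n x) (fun x => ∑ i, q₀ i x) := by
  simpa using VagueTendsto.sum_mul hq (c := fun _ _ => 1) fun _ => continuousOn_const

lemma VagueTendsto.tendstoDistr {q : ℕ → E d → ℝ} {q₀ : E d → ℝ} (hq : VagueTendsto Ω q q₀) :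
    TendstoDistr (fun n => toDistr Ω (q n)) (toDistr Ω q₀) := by
  intro φ
  simp only [toDistr_apply (hq.locInt _), toDistr_apply hq.locInt_limit]
  exact hq.tendsto φ φ.continuous φ.hasCompactSupport φ.tsupport_subset

lemma VagueTendsto.congr {q q' : ℕ → E d → ℝ} {q₀ q₀' : E d → ℝ} (hq : VagueTendsto Ω q q₀)
    (h : ∀ n, q n =ᵐ[volume.restrict (Ω : Set (E d))] q' n)
    (h₀ : q₀ =ᵐ[volume.restrict (Ω : Set (E d))] q₀') : VagueTendsto Ω q' q₀' := by
  refine ⟨fun n => (hq.locInt n).congr (h n), hq.locInt_limit.congr h₀,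
    fun ψ hψ hψc hψΩ => ?_⟩
  have key : ∀ {f g : E d → ℝ}, f =ᵐ[volume.restrict (Ω : Set (E d))] g →
      ∫ x, ψ x * f x = ∫ x, ψ x * g x := by
    intro f g hfg
    rw [Filter.EventuallyEq, ae_restrict_iff' Ω.isOpen.measurableSet] at hfg
    refine integral_congr_ae ?_
    filter_upwards [hfg] with x hx
    by_cases hxΩ : x ∈ (Ω : Set (E d))
    · rw [hx hxΩ]
    · rw [image_eq_zero_of_notMem_tsupport fun hx' => hxΩ (hψΩ hx')]
      simp
  rw [← key h₀]
  refine (hq.tendsto ψ hψ hψc hψΩ).congr fun n => key (h n)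

lemma vagueTendsto_of_weak {u : ℕ → E d → ℝ} {v : E d → ℝ}
    (hu : ∀ n, MemLp (u n) 2 (volume.restrict (Ω : Set (E d))))
    (hv : MemLp v 2 (volume.restrict (Ω : Set (E d)))) (h : TendstoWeakL2 Ω u v) :
    VagueTendsto Ω u v := by
  refine ⟨fun n => locallyIntegrableOn_of_memLp (by norm_num) (hu n),
    locallyIntegrableOn_of_memLp (by norm_num) hv, fun ψ hψ hψc hψΩ => ?_⟩
  have key : ∀ w : E d → ℝ, ∫ x in (Ω : Set (E d)), w x * ψ x = ∫ x, ψ x * w x := by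
    intro w
    rw [setIntegral_eq_integral_of_forall_compl_eq_zero fun x hx => by
      rw [image_eq_zero_of_notMem_tsupport fun h => hx (hψΩ h), mul_zero]]
    simp only [mul_comm]
  have := h ψ ((hψ.memLp_of_hasCompactSupport hψc).restrict _)
  simpa only [key] using this

/-- The curl-curl lemma in terms of functions on `Ω`. -/
lemma WeakCurlLimit.vagueTendsto {v w : ℕ → Fin d → E d → ℝ} {v₀ w₀ : Fin d → E d → ℝ}
    (hv : ∀ n k, MemLp (v n k) 2 (volume.restrict (Ω : Set (E d))))
    (hw : ∀ n k, MemLp (w n k) 2 (volume.restrict (Ω : Set (E d))))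
    (hv₀ : ∀ k, MemLp (v₀ k) 2 (volume.restrict (Ω : Set (E d))))
    (hw₀ : ∀ k, MemLp (w₀ k) 2 (volume.restrict (Ω : Set (E d))))
    (h : WeakCurlLimit Ω (fun n k => extend Ω (v n k)) (fun k => extend Ω (v₀ k)))
    (h' : WeakCurlLimit Ω (fun n k => extend Ω (w n k)) (fun k => extend Ω (w₀ k)))
    (k l : Fin d) :
    VagueTendsto Ω (fun n x => v n k x * w n l x - v n l x * w n k x)
      (fun x => v₀ k x * w₀ l x - v₀ l x * w₀ k x) := by
  have hloc : ∀ {f g : E d → ℝ}, MemLp f 2 (volume.restrict (Ω : Set (E d))) →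
      MemLp g 2 (volume.restrict (Ω : Set (E d))) →
      LocallyIntegrableOn (fun x => f x * g x) Ω := fun hf hg =>
    locallyIntegrableOn_of_memLp le_rfl (memLp_one_iff_integrable.2 (hf.integrable_mul hg))
  refine ⟨fun n => (hloc (hv n k) (hw n l)).sub (hloc (hv n l) (hw n k)),
    (hloc (hv₀ k) (hw₀ l)).sub (hloc (hv₀ l) (hw₀ k)), fun ψ hψ hψc hψΩ => ?_⟩
  have key : ∀ {f g f' g' : E d → ℝ}, MemLp f 2 (volume.restrict (Ω : Set (E d))) →
      MemLp g 2 (volume.restrict (Ω : Set (E d))) →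
      MemLp f' 2 (volume.restrict (Ω : Set (E d))) →
      MemLp g' 2 (volume.restrict (Ω : Set (E d))) →
      ∫ x, ψ x * (f x * g x - f' x * g' x) = tri ψ (extend Ω f) (extend Ω g)
        - tri ψ (extend Ω f') (extend Ω g') := by
    intro f g f' g' hf hg hf' hg'
    rw [tri_extend hf hg hψΩ, tri_extend hf' hg' hψΩ, ← integral_sub
      (integrable_mul_of_hasCompactSupport (hloc hf hg) hψ hψc hψΩ)
      (integrable_mul_of_hasCompactSupport (hloc hf' hg') hψ hψc hψΩ)]
    simp only [mul_sub]
  rw [key (hv₀ k) (hw₀ l) (hv₀ l) (hw₀ k)]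
  refine (h.tendsto_tri h' hψ hψc hψΩ k l).congr fun n => ?_
  rw [key (hv n k) (hw n l) (hv n l) (hw n k)]

/-! ### Continuity of the coefficients -/

section Metric

variable {g : E d → Matrix (Fin d) (Fin d) ℝ}

lemma IsMetricOn.continuousOn_inv (hg : IsMetricOn Ω g) (k l : Fin d) :
    ContinuousOn (fun x => (g x)⁻¹ k l) Ω := by
  have h1 : ContinuousOn g Ω :=
    continuousOn_pi.2 fun i => continuousOn_pi.2 fun j => (hg.contDiffOn i j).continuousOn
  have hdet : ContinuousOn (fun x => (g x).det) Ω :=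
    (continuous_id.matrix_det).comp_continuousOn h1
  have hadj : ContinuousOn (fun x => (g x).adjugate k l) Ω :=
    ((continuous_id.matrix_adjugate).matrix_elem k l).comp_continuousOn h1
  have h2 : ∀ x ∈ (Ω : Set (E d)), (g x).det ≠ 0 := fun x hx => (hg.posDef x hx).det_pos.ne'
  refine ((hdet.inv₀ h2).mul hadj).congr fun x hx => ?_
  rw [Matrix.inv_def, Matrix.smul_apply, Ring.inverse_eq_inv', smul_eq_mul]
  rfl

lemma IsMetricOn.continuousOn_pd (hg : IsMetricOn Ω g) (i k l : Fin d) :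
    ContinuousOn (pd i (fun x => g x k l)) Ω :=
  ((hg.contDiffOn k l).continuousOn_fderiv_of_isOpen Ω.isOpen (by norm_num)).clm_apply
    continuousOn_const

lemma IsMetricOn.continuousOn_christoffel (hg : IsMetricOn Ω g) (k i j : Fin d) :
    ContinuousOn (christoffel g k i j) Ω :=
  continuousOn_const.mul <| continuousOn_finsetSum _ fun l _ => (hg.continuousOn_inv k l).mul
    (((hg.continuousOn_pd j i l).add (hg.continuousOn_pd i j l)).sub (hg.continuousOn_pd l i j))

end Metric

/-! ### Fields -/

/-- The indices of the components of a field. -/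
abbrev Comp (d N : ℕ) : Type := (Fin N × Fin d × Fin d) ⊕ (Fin N × Fin d × Fin N)

/-- The components of a field. -/
def Field.comp (F : Field d N) : Comp d N → E d → ℝ :=
  Sum.elim (fun p => F.h p.1 p.2.1 p.2.2) (fun p => F.κ p.1 p.2.1 p.2.2)

/-- A field in `L²(Ω)` as an element of a Hilbert space. -/
def Field.vec (Ω : Opens (E d)) (F : Field d N) : PiLp 2 (fun _ : Comp d N => L2 d) :=
  WithLp.toLp 2 fun p => extend Ω (F.comp p)

lemma Field.MemL2.memLp {F : Field d N} (hF : F.MemL2 Ω) (p : Comp d N) :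
    MemLp (F.comp p) 2 (volume.restrict (Ω : Set (E d))) := by
  rcases p with p | p
  · exact hF.1 _ _ _
  · exact hF.2 _ _ _

lemma Field.MemL2.l2Norm_eq {F : Field d N} (hF : F.MemL2 Ω) :
    F.l2Norm Ω = ENNReal.ofReal ‖F.vec Ω‖ := by
  have h1 : ∀ p, eLpNorm (F.comp p) 2 (volume.restrict (Ω : Set (E d))) ^ 2
      = ENNReal.ofReal (‖extend Ω (F.comp p)‖ ^ 2) := by
    intro p
    rw [norm_extend (hF.memLp p), ENNReal.ofReal_pow ENNReal.toReal_nonneg,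
      ENNReal.ofReal_toReal (hF.memLp p).2.ne]
  have h2 : (∑ a, ∑ i, ∑ j, eLpNorm (F.h a i j) 2 (volume.restrict (Ω : Set (E d))) ^ 2)
      + ∑ a, ∑ l, ∑ b, eLpNorm (F.κ a l b) 2 (volume.restrict (Ω : Set (E d))) ^ 2
      = ∑ p, eLpNorm (F.comp p) 2 (volume.restrict (Ω : Set (E d))) ^ 2 := by
    simp only [Fintype.sum_sum_type, Fintype.sum_prod_type]
    rfl
  rw [Field.l2Norm, h2]
  simp only [h1]
  rw [← ENNReal.ofReal_sum_of_nonneg fun _ _ => sq_nonneg _, PiLp.norm_eq_of_L2,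
    Real.sqrt_eq_rpow, ENNReal.ofReal_rpow_of_nonneg (Finset.sum_nonneg fun _ _ => sq_nonneg _)
      (by norm_num)]
  rfl

/-- The field with given components. -/
def Field.ofVec (x : PiLp 2 (fun _ : Comp d N => L2 d)) : Field d N where
  h a i j := x (Sum.inl (a, i, j))
  κ a l b := x (Sum.inr (a, l, b))

lemma Field.comp_ofVec (x : PiLp 2 (fun _ : Comp d N => L2 d)) (p : Comp d N) :
    (Field.ofVec x).comp p = x p := by
  cases p <;> rfl

/-- Bounded sequences of fields in `L²(Ω)` have weakly convergent subsequences. -/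
lemma exists_weakly_convergent_subseq {F : ℕ → Field d N} (hF : ∀ n, (F n).MemL2 Ω) {C : ℝ}
    (hC : 0 ≤ C) (hb : ∀ n, (F n).l2Norm Ω ≤ ENNReal.ofReal C) :
    ∃ (s : ℕ → ℕ) (G : Field d N), StrictMono s ∧ G.MemL2 Ω ∧ G.l2Norm Ω ≤ ENNReal.ofReal C ∧
      ∀ p f, Tendsto (fun n => ⟪extend Ω ((F (s n)).comp p), f⟫) atTop
        (𝓝 ⟪extend Ω (G.comp p), f⟫) := by
  classical
  have hbound : ∀ n, ‖(F n).vec Ω‖ ≤ C := fun n => by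
    have := hb n
    rwa [(hF n).l2Norm_eq, ENNReal.ofReal_le_ofReal_iff hC] at this
  obtain ⟨s, x, hs, hx⟩ := exists_weak_limit hbound
  have hG : (Field.ofVec x).MemL2 Ω :=
    ⟨fun a i j => memLp_coe_restrict _, fun a l b => memLp_coe_restrict _⟩
  have hcomp : ∀ p f, Tendsto (fun n => ⟪extend Ω ((F (s n)).comp p), f⟫) atTop
      (𝓝 ⟪extend Ω ((Field.ofVec x).comp p), f⟫) := by
    intro p f
    rw [Field.comp_ofVec]
    refine tendsto_inner_extend (fun n => (hF (s n)).memLp p) (fun f => ?_) f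
    -- Vectors with one nonzero entry isolate the components.
    have := hx (WithLp.toLp 2 (Pi.single p f))
    simpa [PiLp.inner_apply, Pi.single_apply, Field.vec, apply_ite] using this
  refine ⟨s, Field.ofVec x, hs, hG, ?_, hcomp⟩
  rw [hG.l2Norm_eq, ENNReal.ofReal_le_ofReal_iff hC]
  -- Working with the full vector of components, not one at a time, preserves the constant `C`.
  refine norm_le_of_weak_limit (fun n => hbound (s n)) ?_
  simp only [PiLp.inner_apply]
  exact tendsto_finsetSum _ fun p _ => hcomp p _

lemma norm_extend_le_of_l2Norm_le {F : Field d N} (hF : F.MemL2 Ω) {C : ℝ} (hC : 0 ≤ C)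
    (hb : F.l2Norm Ω ≤ ENNReal.ofReal C) (p : Comp d N) : ‖extend Ω (F.comp p)‖ ≤ C := by
  rw [hF.l2Norm_eq, ENNReal.ofReal_le_ofReal_iff hC] at hb
  exact (PiLp.norm_apply_le (F.vec Ω) p).trans hb

end

/-! ### Passage to the limit in the Gauss–Codazzi–Ricci system. -/

section

variable {d N : ℕ} {Ω : Opens (E d)} {g : E d → Matrix (Fin d) (Fin d) ℝ}

/-! ### Convergence of the terms of the system -/

/-- A sequence of fields in `L²(Ω)` that converges weakly and for which each of the vector fields
`h^a_{·j}` and `κ^a_{·b}` satisfies the hypotheses of the curl-curl lemma. -/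
structure FieldLimit (Ω : Opens (E d)) (F : ℕ → Field d N) (G : Field d N) : Prop where
  memL2 : ∀ n, (F n).MemL2 Ω
  memL2_limit : G.MemL2 Ω
  weak : ∀ p f, Tendsto (fun n => ⟪extend Ω ((F n).comp p), f⟫) atTop
    (𝓝 ⟪extend Ω (G.comp p), f⟫)
  curl_h : ∀ a j, WeakCurlLimit Ω (fun n k => extend Ω ((F n).h a k j))
    (fun k => extend Ω (G.h a k j))
  curl_κ : ∀ a b, WeakCurlLimit Ω (fun n k => extend Ω ((F n).κ a k b))
    (fun k => extend Ω (G.κ a k b))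

namespace FieldLimit

variable {F : ℕ → Field d N} {G : Field d N}

lemma weak_h (hF : FieldLimit Ω F G) (a : Fin N) (i j : Fin d) :
    TendstoWeakL2 Ω (fun n => (F n).h a i j) (G.h a i j) :=
  tendstoWeakL2_of_extend (fun n => (hF.memL2 n).1 a i j) (hF.memL2_limit.1 a i j)
    (hF.weak (Sum.inl (a, i, j)))

lemma weak_κ (hF : FieldLimit Ω F G) (a : Fin N) (l : Fin d) (b : Fin N) :
    TendstoWeakL2 Ω (fun n => (F n).κ a l b) (G.κ a l b) :=
  tendstoWeakL2_of_extend (fun n => (hF.memL2 n).2 a l b) (hF.memL2_limit.2 a l b)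
    (hF.weak (Sum.inr (a, l, b)))

lemma vague_h (hF : FieldLimit Ω F G) (a : Fin N) (i j : Fin d) :
    VagueTendsto Ω (fun n => (F n).h a i j) (G.h a i j) :=
  vagueTendsto_of_weak (fun n => (hF.memL2 n).1 a i j) (hF.memL2_limit.1 a i j) (hF.weak_h a i j)

lemma vague_hh (hF : FieldLimit Ω F G) (a b : Fin N) (i j k l : Fin d) :
    VagueTendsto Ω
      (fun n x => (F n).h a k j x * (F n).h b l i x - (F n).h a l j x * (F n).h b k i x)
      (fun x => G.h a k j x * G.h b l i x - G.h a l j x * G.h b k i x) :=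
  WeakCurlLimit.vagueTendsto (v := fun n k => (F n).h a k j) (w := fun n k => (F n).h b k i)
    (fun n k => (hF.memL2 n).1 a k j) (fun n k => (hF.memL2 n).1 b k i)
    (fun k => hF.memL2_limit.1 a k j) (fun k => hF.memL2_limit.1 b k i)
    (hF.curl_h a j) (hF.curl_h b i) k l

lemma vague_κκ (hF : FieldLimit Ω F G) (a b b' c : Fin N) (k l : Fin d) :
    VagueTendsto Ω
      (fun n x => (F n).κ a k b x * (F n).κ b' l c x - (F n).κ a l b x * (F n).κ b' k c x)
      (fun x => G.κ a k b x * G.κ b' l c x - G.κ a l b x * G.κ b' k c x) :=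
  WeakCurlLimit.vagueTendsto (v := fun n k => (F n).κ a k b) (w := fun n k => (F n).κ b' k c)
    (fun n k => (hF.memL2 n).2 a k b) (fun n k => (hF.memL2 n).2 b' k c)
    (fun k => hF.memL2_limit.2 a k b) (fun k => hF.memL2_limit.2 b' k c)
    (hF.curl_κ a b) (hF.curl_κ b' c) k l

lemma vague_κh (hF : FieldLimit Ω F G) (a b b' : Fin N) (i k l : Fin d) :
    VagueTendsto Ω
      (fun n x => (F n).κ a k b x * (F n).h b' l i x - (F n).κ a l b x * (F n).h b' k i x)
      (fun x => G.κ a k b x * G.h b' l i x - G.κ a l b x * G.h b' k i x) :=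
  WeakCurlLimit.vagueTendsto (v := fun n k => (F n).κ a k b) (w := fun n k => (F n).h b' k i)
    (fun n k => (hF.memL2 n).2 a k b) (fun n k => (hF.memL2 n).1 b' k i)
    (fun k => hF.memL2_limit.2 a k b) (fun k => hF.memL2_limit.1 b' k i)
    (hF.curl_κ a b) (hF.curl_h b' i) k l

lemma isSymm (hF : FieldLimit Ω F G) (h : ∀ n, (F n).IsSymm Ω) : G.IsSymm Ω := by
  intro a i j
  have := ae_eq_mul_of_weak_limit (fun n => (hF.memL2 n).1 a i j) (fun n => (hF.memL2 n).1 a j i)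
    (hF.memL2_limit.1 a i j) (hF.memL2_limit.1 a j i) (hF.weak (Sum.inl (a, i, j)))
    (hF.weak (Sum.inl (a, j, i))) 1 (fun n => by simpa only [one_mul] using h n a i j)
  simpa only [one_mul] using this

lemma isAntisymm (hF : FieldLimit Ω F G) (h : ∀ n, (F n).IsAntisymm Ω) : G.IsAntisymm Ω := by
  intro a l b
  have := ae_eq_mul_of_weak_limit (fun n => (hF.memL2 n).2 a l b) (fun n => (hF.memL2 n).2 b l a)
    (hF.memL2_limit.2 a l b) (hF.memL2_limit.2 b l a) (hF.weak (Sum.inr (a, l, b)))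
    (hF.weak (Sum.inr (b, l, a))) (-1) (fun n => by simpa only [neg_one_mul] using h n a l b)
  simpa only [neg_one_mul] using this

/-- In the Ricci term the antisymmetrized index of `h^a` is its second one, while the curl bounds
concern the first. Symmetry of `h` transposes that factor. -/
lemma vague_hh_symm (hF : FieldLimit Ω F G) (h : ∀ n, (F n).IsSymm Ω) (a b : Fin N)
    (k l m n : Fin d) :
    VagueTendsto Ω
      (fun ν x => (F ν).h a m l x * (F ν).h b k n x - (F ν).h a m k x * (F ν).h b l n x)
      (fun x => G.h a m l x * G.h b k n x - G.h a m k x * G.h b l n x) := by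
  have key : ∀ {H : Field d N}, H.IsSymm Ω →
      (fun x => H.h a l m x * H.h b k n x - H.h a k m x * H.h b l n x)
        =ᵐ[volume.restrict (Ω : Set (E d))]
      (fun x => H.h a m l x * H.h b k n x - H.h a m k x * H.h b l n x) := by
    intro H hH
    filter_upwards [hH a l m, hH a k m] with x h1 h2
    rw [h1, h2]
  exact (hF.vague_hh a b n m l k).congr (fun ν => key (h ν)) (key (hF.isSymm h))

lemma vague_ricciQuadH (hF : FieldLimit Ω F G) (hg : IsMetricOn Ω g)
    (h : ∀ n, (F n).IsSymm Ω) (a b : Fin N) (k l : Fin d) :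
    VagueTendsto Ω (fun n => (F n).ricciQuadH g a b k l) (G.ricciQuadH g a b k l) :=
  VagueTendsto.sum fun m => VagueTendsto.sum_mul (fun n => hF.vague_hh_symm h a b k l m n)
    fun n => hg.continuousOn_inv m n

lemma quadraticTermsConverge (hF : FieldLimit Ω F G) (hg : IsMetricOn Ω g)
    (h : ∀ n, (F n).IsSymm Ω) : QuadraticTermsConverge Ω g F G where
  hh a b i j k l := (hF.vague_hh a b i j l k).tendstoDistr
  κκ a b b' c k l := (hF.vague_κκ a b b' c k l).tendstoDistr
  κh a b b' i k l := (hF.vague_κh a b b' i k l).tendstoDistr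
  gauss i j k l := VagueTendsto.tendstoDistr (VagueTendsto.sum fun a => hF.vague_hh a a l i j k)
  codazzi a j k l := VagueTendsto.tendstoDistr (VagueTendsto.sum fun b => hF.vague_κh a b b j k l)
  ricciH a b k l := (hF.vague_ricciQuadH hg h a b k l).tendstoDistr
  ricciK a b k l := VagueTendsto.tendstoDistr (VagueTendsto.sum fun c => hF.vague_κκ a c c b k l)

lemma tendsto_codazziLin (hF : FieldLimit Ω F G) (hg : IsMetricOn Ω g) (a : Fin N)
    (j k l : Fin d) :
    TendstoDistr (fun n => toDistr Ω ((F n).codazziLin g a j k l))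
      (toDistr Ω (G.codazziLin g a j k l)) := by
  -- The two families of terms are summed over `Fin d ⊕ Fin d`, the sign of the second being put in
  -- its coefficient.
  have h := VagueTendsto.sum_mul (ι := Fin d ⊕ Fin d)
    (q := fun s n => s.elim (fun m => (F n).h a k m) (fun m => (F n).h a l m))
    (q₀ := fun s => s.elim (fun m => G.h a k m) (fun m => G.h a l m))
    (c := fun s => s.elim (fun m => christoffel g m l j) (fun m x => -christoffel g m k j x))
    (Ω := Ω) ?_ ?_
  · have h' := h.tendstoDistr
    simp only [Fintype.sum_sum_type, Sum.elim_inl, Sum.elim_inr, neg_mul,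
      Finset.sum_neg_distrib, ← sub_eq_add_neg, ← Finset.sum_sub_distrib] at h'
    exact h'
  · rintro (m | m)
    · exact hF.vague_h a k m
    · exact hF.vague_h a l m
  · rintro (m | m)
    · exact hg.continuousOn_christoffel m l j
    · exact (hg.continuousOn_christoffel m k j).neg

end FieldLimit

lemma WeakCurlLimit.tendsto_curl {w : ℕ → Fin d → E d → ℝ} {w₀ : Fin d → E d → ℝ}
    (hw : ∀ n k, MemLp (w n k) 2 (volume.restrict (Ω : Set (E d))))
    (hw₀ : ∀ k, MemLp (w₀ k) 2 (volume.restrict (Ω : Set (E d))))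
    (h : WeakCurlLimit Ω (fun n k => extend Ω (w n k)) (fun k => extend Ω (w₀ k)))
    (k l : Fin d) :
    TendstoDistr (fun n => GaussCodazziRicci.curl Ω (w n) k l)
      (GaussCodazziRicci.curl Ω w₀ k l) := by
  intro φ
  simp only [curl_apply (hw _), curl_apply hw₀]
  exact ((h.tendsto l _).sub (h.tendsto k _)).neg

lemma TendstoDistr.add {S T : ℕ → 𝓓'(Ω, ℝ)} {S₀ T₀ : 𝓓'(Ω, ℝ)} (hS : TendstoDistr S S₀)
    (hT : TendstoDistr T T₀) : TendstoDistr (fun n => S n + T n) (S₀ + T₀) :=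
  fun φ => (hS φ).add (hT φ)

lemma TendstoDistr.sub {S T : ℕ → 𝓓'(Ω, ℝ)} {S₀ T₀ : 𝓓'(Ω, ℝ)} (hS : TendstoDistr S S₀)
    (hT : TendstoDistr T T₀) : TendstoDistr (fun n => S n - T n) (S₀ - T₀) :=
  fun φ => (hS φ).sub (hT φ)

lemma TendstoDistr.unique {T : ℕ → 𝓓'(Ω, ℝ)} {S S' : 𝓓'(Ω, ℝ)} (h : TendstoDistr T S)
    (h' : TendstoDistr T S') : S = S' := by
  ext φ
  exact tendsto_nhds_unique (h φ) (h' φ)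

lemma TendstoDistr.comp {T : ℕ → 𝓓'(Ω, ℝ)} {S : 𝓓'(Ω, ℝ)} (h : TendstoDistr T S) {s : ℕ → ℕ}
    (hs : StrictMono s) : TendstoDistr (fun n => T (s n)) S :=
  fun φ => (h φ).comp hs.tendsto_atTop

lemma FrameworkA.fieldLimit {F : ℕ → Field d N} {C : ℝ} (hC : 0 ≤ C) (hA : FrameworkA Ω g F C)
    {s : ℕ → ℕ} {G : Field d N} (hG : G.MemL2 Ω)
    (hw : ∀ p f, Tendsto (fun n => ⟪extend Ω ((F (s n)).comp p), f⟫) atTop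
      (𝓝 ⟪extend Ω (G.comp p), f⟫)) : FieldLimit Ω (fun n => F (s n)) G where
  memL2 _ := hA.memL2 _
  memL2_limit := hG
  weak := hw
  curl_h a j :=
    { bounded := ⟨C, fun _ k => norm_extend_le_of_l2Norm_le (hA.memL2 _) hC (hA.bound _)
        (Sum.inl (a, k, j))⟩
      tendsto := fun k => hw (Sum.inl (a, k, j))
      curl := curlNullOn_of_confined (fun n k => (hA.memL2 (s n)).1 a k j) fun k l =>
        let ⟨𝒦, h𝒦, h⟩ := hA.compact_h a j k l
        ⟨𝒦, h𝒦, fun n => h (s n)⟩ }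
  curl_κ a b :=
    { bounded := ⟨C, fun _ k => norm_extend_le_of_l2Norm_le (hA.memL2 _) hC (hA.bound _)
        (Sum.inr (a, k, b))⟩
      tendsto := fun k => hw (Sum.inr (a, k, b))
      curl := curlNullOn_of_confined (fun n k => (hA.memL2 (s n)).2 a k b) fun k l =>
        let ⟨𝒦, h𝒦, h⟩ := hA.compact_κ a b k l
        ⟨𝒦, h𝒦, fun n => h (s n)⟩ }

/-- Each residual converges term by term to the residual of `G`, and to zero by assumption;
distributional limits are unique. The curvature is the same for all `n`, so it needs no convergence
argument. -/
lemma FieldLimit.isWeakSolution {F : ℕ → Field d N} {G : Field d N} (hF : FieldLimit Ω F G)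
    (hg : IsMetricOn Ω g) (hQ : QuadraticTermsConverge Ω g F G)
    (gauss : ∀ i j k l, TendstoDistr (fun n => gaussResidual Ω g (F n) i j k l) 0)
    (codazzi : ∀ a j k l, TendstoDistr (fun n => codazziResidual Ω g (F n) a j k l) 0)
    (ricci : ∀ a b k l, TendstoDistr (fun n => ricciResidual Ω g (F n) a b k l) 0) :
    IsWeakSolution Ω g G where
  memL2 := hF.memL2_limit
  gauss i j k l := TendstoDistr.unique
    ((hQ.gauss i j k l).sub fun _ => tendsto_const_nhds) (gauss i j k l)
  codazzi a j k l := TendstoDistr.unique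
    ((((hF.curl_h a j).tendsto_curl (fun n k => (hF.memL2 n).1 a k j)
      (fun k => hF.memL2_limit.1 a k j) k l).add (hF.tendsto_codazziLin hg a j k l)).add
      (hQ.codazzi a j k l)) (codazzi a j k l)
  ricci a b k l := TendstoDistr.unique
    ((((hF.curl_κ a b).tendsto_curl (fun n k => (hF.memL2 n).2 a k b)
      (fun k => hF.memL2_limit.2 a k b) k l).sub (hQ.ricciH a b k l)).add
      (hQ.ricciK a b k l)) (ricci a b k l)

end

end GaussCodazziRicci

end

open GaussCodazziRicci in
theorem theorem3p2 {d N : ℕ} (Ω : Opens (E d)) (hΩ : Bornology.IsBounded (Ω : Set (E d)))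
    (g : E d → Matrix (Fin d) (Fin d) ℝ) (hg : IsMetricOn Ω g)
    (F : ℕ → Field d N) (hsymm : ∀ n, (F n).IsSymm Ω)
    (C : ℝ) (hC : 0 < C) (hA : FrameworkA Ω g F C) :
    ∃ (s : ℕ → ℕ) (G : Field d N), StrictMono s ∧ G.MemL2 Ω ∧
      (∀ a i j, TendstoWeakL2 Ω (fun n => (F (s n)).h a i j) (G.h a i j)) ∧
      (∀ a l b, TendstoWeakL2 Ω (fun n => (F (s n)).κ a l b) (G.κ a l b)) ∧
      G.l2Norm Ω ≤ ENNReal.ofReal C ∧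
      QuadraticTermsConverge Ω g (fun n => F (s n)) G ∧
      IsWeakSolution Ω g G ∧
      G.IsSymm Ω ∧ ((∀ n, (F n).IsAntisymm Ω) → G.IsAntisymm Ω) := by
  obtain ⟨s, G, hs, hG, hGC, hw⟩ := exists_weakly_convergent_subseq hA.memL2 hC.le hA.bound
  have hF := hA.fieldLimit hC.le hG hw
  have hQ := hF.quadraticTermsConverge hg fun n => hsymm (s n)
  exact ⟨s, G, hs, hG, hF.weak_h, hF.weak_κ, hGC, hQ,
    hF.isWeakSolution hg hQ (fun i j k l => (hA.gauss i j k l).comp hs)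
      (fun a j k l => (hA.codazzi a j k l).comp hs) (fun a b k l => (hA.ricci a b k l).comp hs),
    hF.isSymm fun n => hsymm (s n), fun h => hF.isAntisymm fun n => h (s n)⟩
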